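/- **Notation.** Let $\mathscr A$ be a unital $C^*$-algebra and $n\ge 0$. Let $\mathscr A^{\otimes n+1}_\gamma$ be the projective tensor power, i.e. the completion of the algebraic tensor power $\mathscr A\otimes\dots\otimes\mathscr A$ ($n+1$ factors) for the norm $\|x\|_\gamma=\inf\sum_i\|a_0^{(i)}\|\cdots\|a_n^{(i)}\|$ (infimum over all representations of $x$ as a finite sum of elementary tensors $a_0^{(i)}\otimes\dots\otimes a_n^{(i)}$); it is a Banach algebra. For $a\in\mathscr A$ and $0\le j\le n$ let $a^{(j)}=1\otimes\dots\otimes a\otimes\dots\otimes1$ with $a$ in slot $j$ (slots are counted from $0$), and for $1\le j\le n$ put $\nabla^{(j)}=-a^{(j-1)}+a^{(j)}$ and $\Delta^{(j)}=\exp(\nabla^{(j)})\in\mathscr A^{\otimes n+1}_\gamma$. For an open set $V\subset\mathbb R^m$ and a tuple $b=(b_1,\dots,b_m)$ in a complex unital Banach algebra $B$, the *smooth functional calculus* of $b$ on $V$ is the unital algebra homomorphism $\Phi:C^\infty(V)\to B$ that is continuous for the usual Fréchet topology of $C^\infty(V)$ and sends the coordinate function $x_j$ to $b_j$ for each $j$.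 If there is exactly one such $\Phi$, we write $f_\gamma(b_1,\dots,b_m):=\Phi(f)$. **Theorem (Smooth Operator Substitution Lemma).** Let $a\in\mathscr A$ be selfadjoint and $A:=e^a$. All smooth functional calculi used below exist and are unique, namely those of $(A^{(0)},\dots,A^{(n)})$ on $U^{n+1}$ for each open $U\subset\mathbb R$ with $U\supset\operatorname{spec}A$; of $(\Delta^{(1)},\Delta^{(1)}\Delta^{(2)},\dots,\Delta^{(1)}\cdots\Delta^{(n)})$ on $\mathbb R_{>0}^n$; and, for each $u>0$, of $(uA^{(0)},\dots,uA^{(n)})$ and of $(u,u\Delta^{(1)},u\Delta^{(1)}\Delta^{(2)},\dots,u\Delta^{(1)}\cdots\Delta^{(n)})$ on $\mathbb R_{>0}^{n+1}$. Moreover: (1) Let $U\subset\mathbb R$ be open with $U\supset\operatorname{spec}A$, and let $f:\mathbb R_{\ge0}\times U^{n+1}\to\mathbb C$ be a smooth function such that for each compact $K\subset U$ and each multiindex $\alpha\in\mathbb N^{n+1}$ $$\int_0^\infty\sup_{\lambda\in K^{n+1}}|\partial_\lambda^\alpha f(u,\lambda)|\,du<\infty .$$ Then $F(\lambda):=\int_0^\infty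 f(u,\lambda)\,du$ converges absolutely for each $\lambda\in U^{n+1}$ and defines a smooth function on $U^{n+1}$, the integral $\int_0^\infty f_\gamma(u,A^{(0)},\dots,A^{(n)})\,du$ exists as a Bochner integral with values in $\mathscr A^{\otimes n+1}_\gamma$, where $f_\gamma(u,\cdot)$ is the calculus applied to the function $f(u,\cdot)$, and $$\int_0^\infty f_\gamma(u,A^{(0)},\dots,A^{(n)})\,du=F_\gamma(A^{(0)},\dots,A^{(n)}).$$ (2) Let $f:\mathbb R_{\ge0}^{n+1}\to\mathbb C$ be a smooth function such that for all $0<C_1<C_2$ and each multiindex $\alpha\in\mathbb N^{n+1}$ $$\int_0^\infty\sup_{C_1\le s_j\le C_2,\ 0\le j\le n}\bigl|u^{|\alpha|}(\partial^\alpha f)(us)\bigr|\,du<\infty .$$ Then $F(s)=\int_0^\infty f(us)\,du$ on $\mathbb R_{>0}^{n+1}$ and $G(\lambda)=\int_0^\infty f(u,u\lambda_1,\dots,u\lambda_n)\,du$ on $\mathbb R_{>0}^n$ are given by absolutely convergent integrals and are smooth, and $$\begin{aligned}\int_0^\infty f_\gamma(uA^{(0)},\dots,uA^{(n)})\,du&=F_\gamma(A^{(0)},\dots,A^{(n)})\\&=A^{-1}\,G_\gamma(\Delta^{(1)},\Delta^{(1)}\Delta^{(2)},\dots,\Delta^{(1)}\cdots\Delta^{(n)})\\&=A^{-1}\int_0^\infty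 f_\gamma(u,u\Delta^{(1)},u\Delta^{(1)}\Delta^{(2)},\dots,u\Delta^{(1)}\cdots\Delta^{(n)})\,du,\end{aligned}$$ where $A^{-1}$ acts by multiplication from the left in slot $0$, i.e. stands for $(A^{-1})^{(0)}$. Both integrals exist in the Bochner sense in $\mathscr A^{\otimes n+1}_\gamma$. -/

import Mathlib

open MeasureTheory Set
open scoped TensorProduct ContDiff

/-! ### The projective tensor power of a Banach algebra -/

section ProjTensor

variable {A : Type*} [NormedRing A] [NormedAlgebra ℂ A]

theorem piTensor_norm_mul_le {m : ℕ} (x y : ⨂[ℂ] _ : Fin m, A) : ‖x * y‖ ≤ ‖x‖ * ‖y‖ := by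
  have key : ∀ (x : ⨂[ℂ] _ : Fin m, A) (k : Fin m → A),
      ‖x * PiTensorProduct.tprod ℂ k‖ ≤ ‖x‖ * ∏ i, ‖k i‖ := by
    intro x k
    let g : MultilinearMap ℂ (fun _ : Fin m => A) (⨂[ℂ] _ : Fin m, A) :=
      (LinearMap.mulRight ℂ (PiTensorProduct.tprod ℂ k)).compMultilinearMap
        (PiTensorProduct.tprod ℂ)
    have hP : 0 ≤ ∏ i, ‖k i‖ := Finset.prod_nonneg fun i _ => norm_nonneg _
    have hg : ∀ v, ‖g v‖ ≤ (∏ i, ‖k i‖) * ∏ i, ‖v i‖ := by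
      intro v
      have h1 : g v = PiTensorProduct.tprod ℂ (v * k) := by
        simp [g, PiTensorProduct.tprod_mul_tprod]
      rw [h1]
      refine (PiTensorProduct.projectiveSeminorm_tprod_le _).trans ?_
      rw [← Finset.prod_mul_distrib]
      refine Finset.prod_le_prod (fun i _ => norm_nonneg _) fun i _ => ?_
      rw [mul_comm]
      exact norm_mul_le _ _
    have h2 := PiTensorProduct.norm_eval_le_projectiveSeminorm (g.mkContinuous _ hg) x
    have h3 : PiTensorProduct.lift (g.mkContinuous _ hg).toMultilinearMap x
        = x * PiTensorProduct.tprod ℂ k := by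
      have : PiTensorProduct.lift (g.mkContinuous _ hg).toMultilinearMap
          = LinearMap.mulRight ℂ (PiTensorProduct.tprod ℂ k) := by
        ext v
        simp [g]
      rw [this]
      rfl
    rw [h3] at h2
    refine h2.trans ?_
    rw [mul_comm]
    exact mul_le_mul_of_nonneg_left (MultilinearMap.mkContinuous_norm_le _ hP _) (norm_nonneg _)
  let g : MultilinearMap ℂ (fun _ : Fin m => A) (⨂[ℂ] _ : Fin m, A) :=
    (LinearMap.mulLeft ℂ x).compMultilinearMap (PiTensorProduct.tprod ℂ)
  have hg : ∀ v, ‖g v‖ ≤ ‖x‖ * ∏ i, ‖v i‖ := fun v => key x v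
  have h2 := PiTensorProduct.norm_eval_le_projectiveSeminorm (g.mkContinuous _ hg) y
  have h3 : PiTensorProduct.lift (g.mkContinuous _ hg).toMultilinearMap y = x * y := by
    have : PiTensorProduct.lift (g.mkContinuous _ hg).toMultilinearMap
        = LinearMap.mulLeft ℂ x := by
      ext v
      simp [g]
    rw [this]
    rfl
  rw [h3] at h2
  exact h2.trans
    (mul_le_mul_of_nonneg_right (MultilinearMap.mkContinuous_norm_le _ (norm_nonneg _) _)
      (norm_nonneg _))

/-- The algebraic tensor power `A ⊗ ⋯ ⊗ A` with the projective (semi)norm is a seminormed ring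
for the factorwise product. -/
noncomputable instance piTensorSeminormedRing {m : ℕ} : SeminormedRing (⨂[ℂ] _ : Fin m, A) where
  __ := (inferInstance : SeminormedAddCommGroup (⨂[ℂ] _ : Fin m, A))
  __ := (inferInstance : Ring (⨂[ℂ] _ : Fin m, A))
  norm_mul_le := piTensor_norm_mul_le

variable (A) in
/-- The projective tensor power `A^{⊗ m}_γ`: the completion of the algebraic tensor power
`A ⊗ ⋯ ⊗ A` (`m` factors) for the projective norm. -/
abbrev ProjTensor (m : ℕ) : Type _ := UniformSpace.Completion (⨂[ℂ] _ : Fin m, A)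

noncomputable instance projTensorNormedAlgebra {m : ℕ} : NormedAlgebra ℂ (ProjTensor A m) where
  __ := (inferInstance : Algebra ℂ (ProjTensor A m))
  norm_smul_le := norm_smul_le

/-- `slot j a = 1 ⊗ ⋯ ⊗ a ⊗ ⋯ ⊗ 1`, with `a` in the slot `j`; this is `a^{(j)}`. -/
noncomputable def slot {m : ℕ} (j : Fin m) (a : A) : ProjTensor A m :=
  ((PiTensorProduct.tprod ℂ (Function.update (fun _ : Fin m => (1 : A)) j a) :
    ⨂[ℂ] _ : Fin m, A) : ProjTensor A m)

/-- `∇^{(j)} = - a^{(j-1)} + a^{(j)}` for `1 ≤ j ≤ n`; the index `j` is shifted by one. -/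
noncomputable def nabla {n : ℕ} (a : A) (j : Fin n) : ProjTensor A (n + 1) :=
  - slot j.castSucc a + slot j.succ a

/-- The modular operators `Δ^{(j)} = exp ∇^{(j)}` for `1 ≤ j ≤ n`; the index is shifted by one. -/
noncomputable def modular {n : ℕ} (a : A) (j : Fin n) : ProjTensor A (n + 1) :=
  NormedSpace.exp (nabla a j)

/-- The tuple `(1, Δ^{(1)}, Δ^{(1)} Δ^{(2)}, …, Δ^{(1)} ⋯ Δ^{(n)})`. -/
noncomputable def modularProd {n : ℕ} (a : A) : Fin (n + 1) → ProjTensor A (n + 1) :=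
  Fin.partialProd (modular a)

end ProjTensor

/-! ### The smooth functional calculus of a tuple -/

section SmoothCalculus

/-- The algebra `C^∞(V)` of complex functions that are smooth on `V`. Functions are total; their
values off `V` are irrelevant below. -/
def smoothAlg {m : ℕ} (V : Set (Fin m → ℝ)) : Subalgebra ℂ ((Fin m → ℝ) → ℂ) where
  carrier := {f | ContDiffOn ℝ ∞ f V}
  mul_mem' hf hg := ContDiffOn.mul hf hg
  add_mem' hf hg := ContDiffOn.add hf hg
  algebraMap_mem' _ := contDiffOn_const

/-- The coordinate function `x ↦ x j`. -/
def smoothCoord {m : ℕ} (V : Set (Fin m → ℝ)) (j : Fin m) : smoothAlg V :=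
  ⟨fun x => (x j : ℂ), by
    change ContDiffOn ℝ ∞ (fun x : Fin m → ℝ => (x j : ℂ)) V
    exact (Complex.ofRealCLM.contDiff.comp (contDiff_apply ℝ ℝ j)).contDiffOn⟩

variable {B : Type*} [NormedRing B] [NormedAlgebra ℂ B]

/-- `Φ : C^∞(V) → B` is a smooth functional calculus on the open set `V` for the tuple `b`: a
unital algebra homomorphism that sends the coordinate function `x_j` to `b_j` and is continuous for
the usual Fréchet topology of `C^∞(V)` (uniform convergence of all derivatives on compact sets),
i.e. bounded by finitely many derivatives on a compact subset of `V`. -/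
structure IsSmoothCalculus {m : ℕ} (V : Set (Fin m → ℝ)) (b : Fin m → B)
    (Φ : smoothAlg V →ₐ[ℂ] B) : Prop where
  map_coord : ∀ j, Φ (smoothCoord V j) = b j
  continuous : ∃ K : Set (Fin m → ℝ), IsCompact K ∧ K ⊆ V ∧ ∃ (N : ℕ) (C : ℝ),
    ∀ (f : smoothAlg V) (M : ℝ), 0 ≤ M →
      (∀ k ≤ N, ∀ x ∈ K, ‖iteratedFDeriv ℝ k (f : (Fin m → ℝ) → ℂ) x‖ ≤ M) → ‖Φ f‖ ≤ C * M

/-- The tuple `b` has a smooth functional calculus on `V`, and only one. -/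
def HasSmoothCalculus {m : ℕ} (V : Set (Fin m → ℝ)) (b : Fin m → B) : Prop :=
  ∃! Φ : smoothAlg V →ₐ[ℂ] B, IsSmoothCalculus V b Φ

open Classical in
/-- `f_γ(b_1, …, b_m)`: the value at `f ∈ C^∞(V)` of the smooth functional calculus on `V` for the
tuple `b` (meaningful if `HasSmoothCalculus V b`). -/
noncomputable def smoothCalc {m : ℕ} (V : Set (Fin m → ℝ)) (f : (Fin m → ℝ) → ℂ)
    (b : Fin m → B) : B :=
  if h : (∃ Φ : smoothAlg V →ₐ[ℂ] B, IsSmoothCalculus V b Φ) ∧ f ∈ smoothAlg V then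
    h.1.choose ⟨f, h.2⟩
  else 0

/-- The iterated partial derivative `∂_{i 0} ⋯ ∂_{i (k-1)} f`. -/
noncomputable def iterPartial {m k : ℕ} (i : Fin k → Fin m) (f : (Fin m → ℝ) → ℂ)
    (x : Fin m → ℝ) : ℂ :=
  iteratedFDeriv ℝ k f x fun l => Pi.single (i l) 1

/-- The `m`-fold power `S^m ⊆ ℝ^m` of a set of reals. -/
def setPow (m : ℕ) (S : Set ℝ) : Set (Fin m → ℝ) := Set.univ.pi fun _ => S

end SmoothCalculus

/-! ### Iterated partial derivatives -/

section IterPartial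

variable {m : ℕ}

/-! The heart of the matter is a smooth functional calculus for the slots of a selfadjoint `A` in
the projective tensor power. Taylor's formula `φ(l) = ∫ φ''(t) (l - t)₊ dt` for compactly supported
`φ` passes to `φ(A) = ∫ φ''(t) (A - t)₊ dt`, and `t ↦ (A - t)₊` is norm continuous. Hence, with a
product cutoff `χ` equal to 1 near the power of the spectrum, `Φ(f) = ∫ ∂₀² ⋯ ∂ₙ² (χ f)(x) (A - x₀)₊
⊗ ⋯ ⊗ (A - xₙ)₊ dx` is an integral of a continuous compactly supported function, bounded by finitely
many derivatives of `f`. By Fubini it sends the monomial with exponents `s_j` to the elementary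
tensor of the powers `A ^ s_j`, so it is multiplicative on polynomials
(`exists_isSmoothCalculus_slot`).

Polynomials are dense in `C^∞(V)`: cut `f` off and convolve with a polynomial close to a bump
function; the convolution is a polynomial, and all derivatives fall on the cut-off function
(`exists_mvPolynomial_near_smooth`). Density makes `Φ` multiplicative everywhere and gives
uniqueness of every calculus.

A calculus is dominated by the derivatives up to some order `N` on a compact `K`, that is, by the
norm of a jet map into a finite power of `C(K, ℂ)`. The hypotheses say that the jets of `f(u, ·)`
are Bochner integrable there, and differentiation under the integral identifies their integral with
the jet of `F`. So the calculus commutes with the integral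
(`IsIntegrableFamily.integrableOn_smoothCalc`), which is part (1).

For part (2), the products of modular operators telescope to `(A⁻¹)^{(0)} A^{(j)}`
(`modularProd_eq`), so their calculus is that of the slots pulled back along `x ↦ (x_j / x₀)_j`.
Rescaling `u` gives `F(s) = s₀⁻¹ G(s₁/s₀, …, sₙ/s₀)`; applying `Φ` to this scalar identity gives the
middle equality, and part (1)'s argument for the two calculi gives the outer ones. -/

theorem iterPartial_zero (i : Fin 0 → Fin m) (f : (Fin m → ℝ) → ℂ) : iterPartial i f = f := by
  ext x; simp [iterPartial]

theorem iterPartial_succ {k : ℕ} (i : Fin (k + 1) → Fin m) {f : (Fin m → ℝ) → ℂ} {x : Fin m → ℝ}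
    (hf : ContDiffAt ℝ ∞ f x) :
    iterPartial i f x = fderiv ℝ (iterPartial (Fin.tail i) f) x (Pi.single (i 0) 1) := by
  have h : DifferentiableAt ℝ (iteratedFDeriv ℝ k f) x :=
    (hf.iteratedFDeriv_right (m := 1) (by exact_mod_cast le_top)).differentiableAt (by simp)
  exact h.iteratedFDeriv_succ_apply_left'

theorem ContDiffAt.iterPartial {k : ℕ} (i : Fin k → Fin m) {f : (Fin m → ℝ) → ℂ}
    {x : Fin m → ℝ} (hf : ContDiffAt ℝ ∞ f x) : ContDiffAt ℝ ∞ (iterPartial i f) x := by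
  have h : ContDiffAt ℝ ∞ (iteratedFDeriv ℝ k f) x :=
    hf.iteratedFDeriv_right (by exact_mod_cast le_top)
  exact (ContinuousMultilinearMap.apply ℝ (fun _ : Fin k => Fin m → ℝ) ℂ
    (fun l => Pi.single (i l) 1)).contDiff.contDiffAt.comp x h

theorem norm_iterPartial_le {k : ℕ} (i : Fin k → Fin m) (f : (Fin m → ℝ) → ℂ) (x : Fin m → ℝ) :
    ‖iterPartial i f x‖ ≤ ‖iteratedFDeriv ℝ k f x‖ := by
  refine ((iteratedFDeriv ℝ k f x).le_opNorm _).trans ?_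
  refine mul_le_of_le_one_right (norm_nonneg _) ?_
  refine Finset.prod_le_one (fun _ _ => norm_nonneg _) fun l _ => ?_
  rw [Pi.norm_single]; simp

/-- Expand every argument in the standard basis; in the sup norm each coordinate is at most the
norm. Together with `norm_iterPartial_le` this makes bounds on partial derivatives and on full
derivatives interchangeable. -/
theorem norm_iteratedFDeriv_le_sum (k : ℕ) (f : (Fin m → ℝ) → ℂ) (x : Fin m → ℝ) :
    ‖iteratedFDeriv ℝ k f x‖ ≤ ∑ i : Fin k → Fin m, ‖iterPartial i f x‖ := by
  refine ContinuousMultilinearMap.opNorm_le_bound (by positivity) fun v => ?_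
  have hv : v = fun l => ∑ j, v l j • (Pi.single j 1 : Fin m → ℝ) := by
    funext l
    exact pi_eq_sum_univ' (v l)
  conv_lhs => rw [hv]
  rw [ContinuousMultilinearMap.map_sum, Finset.sum_mul]
  refine (norm_sum_le _ _).trans (Finset.sum_le_sum fun i _ => ?_)
  rw [ContinuousMultilinearMap.map_smul_univ, norm_smul, mul_comm]
  refine mul_le_mul_of_nonneg_left ?_ (norm_nonneg _)
  rw [norm_prod]
  exact Finset.prod_le_prod (fun _ _ => norm_nonneg _) fun l _ => norm_le_pi_norm (v l) (i l)

theorem Filter.EventuallyEq.iterPartial_eq {k : ℕ} (i : Fin k → Fin m) {f g : (Fin m → ℝ) → ℂ}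
    {x : Fin m → ℝ} (h : f =ᶠ[nhds x] g) : iterPartial i f x = iterPartial i g x := by
  simp only [iterPartial, (h.iteratedFDeriv ℝ k).eq_of_nhds]

theorem iterPartial_add {k : ℕ} (i : Fin k → Fin m) {f g : (Fin m → ℝ) → ℂ} {x : Fin m → ℝ}
    (hf : ContDiffAt ℝ ∞ f x) (hg : ContDiffAt ℝ ∞ g x) :
    iterPartial i (f + g) x = iterPartial i f x + iterPartial i g x := by
  simp only [iterPartial]
  rw [iteratedFDeriv_add_apply (hf.of_le (by exact_mod_cast le_top))
    (hg.of_le (by exact_mod_cast le_top))]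
  rfl

theorem iterPartial_const_smul {k : ℕ} (i : Fin k → Fin m) {f : (Fin m → ℝ) → ℂ} {x : Fin m → ℝ}
    (c : ℂ) (hf : ContDiffAt ℝ ∞ f x) :
    iterPartial i (c • f) x = c • iterPartial i f x := by
  simp only [iterPartial]
  rw [iteratedFDeriv_const_smul_apply (hf.of_le (by exact_mod_cast le_top))]
  rfl

/-- Each letter of the word differentiates only the factor that depends on that variable, so a
factor is differentiated as often as its index occurs. -/
theorem iterPartial_prod {k : ℕ} (i : Fin k → Fin m) {φ : Fin m → ℝ → ℂ}
    (hφ : ∀ j, ContDiff ℝ ∞ (φ j)) (x : Fin m → ℝ) :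
    iterPartial i (fun x => ∏ j, φ j (x j)) x
      = ∏ j, iteratedDeriv (∑ l, if i l = j then 1 else 0) (φ j) (x j) := by
  induction k generalizing x with
  | zero => simp [iterPartial_zero]
  | succ k ih =>
    have hsm : ContDiff ℝ ∞ (fun x : Fin m → ℝ => ∏ j, φ j (x j)) :=
      contDiff_prod fun j _ => (hφ j).comp (contDiff_apply ℝ ℝ j)
    rw [iterPartial_succ _ hsm.contDiffAt, funext (ih (Fin.tail i))]
    have hd : ∀ j (n : ℕ) (y : ℝ), HasDerivAt (iteratedDeriv n (φ j))
        (iteratedDeriv (n + 1) (φ j) y) y := by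
      intro j n y
      rw [iteratedDeriv_succ]
      exact ((hφ j).differentiable_iteratedDeriv n (by exact_mod_cast ENat.natCast_lt_top n)
        y).hasDerivAt
    have h1 : ∀ j ∈ Finset.univ, HasFDerivAt (fun x : Fin m → ℝ =>
        iteratedDeriv (∑ l, if Fin.tail i l = j then 1 else 0) (φ j) (x j))
        ((ContinuousLinearMap.toSpanSingleton ℝ
          (iteratedDeriv ((∑ l, if Fin.tail i l = j then 1 else 0) + 1) (φ j) (x j))).comp
          (ContinuousLinearMap.proj (R := ℝ) (φ := fun _ : Fin m => ℝ) j)) x :=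
      fun j _ => HasFDerivAt.comp (f := fun x : Fin m → ℝ => x j) x
        (hd j _ (x j)).hasFDerivAt
        (ContinuousLinearMap.proj (R := ℝ) (φ := fun _ : Fin m => ℝ) j).hasFDerivAt
    rw [(HasFDerivAt.finsetProd h1).fderiv]
    simp only [_root_.sum_apply, _root_.smul_apply,
      ContinuousLinearMap.comp_apply, ContinuousLinearMap.proj_apply,
      ContinuousLinearMap.toSpanSingleton_apply]
    rw [Finset.sum_eq_single (i 0)]
    · rw [← Finset.prod_erase_mul _ _ (Finset.mem_univ (i 0))]
      simp only [Pi.single_eq_same, one_smul, smul_eq_mul]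
      congr 1
      · refine Finset.prod_congr rfl fun j hj => ?_
        rw [Fin.sum_univ_succ, if_neg (Finset.ne_of_mem_erase hj).symm, zero_add]; rfl
      · rw [Fin.sum_univ_succ, if_pos rfl, add_comm]; rfl
    · intro j _ hj
      simp [Pi.single_eq_of_ne hj]
    · simp

/-- Joint smoothness of the partial derivatives of a smooth family. -/
theorem ContDiffAt.iterPartial_uncurry {k : ℕ} (i : Fin k → Fin m) {f : ℝ → (Fin m → ℝ) → ℂ}
    {W : Set (ℝ × (Fin m → ℝ))} (hW : IsOpen W)
    (hf : ContDiffOn ℝ ∞ (fun p : ℝ × (Fin m → ℝ) => f p.1 p.2) W) :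
    ContDiffOn ℝ ∞ (fun p : ℝ × (Fin m → ℝ) => _root_.iterPartial i (f p.1) p.2) W := by
  induction k with
  | zero => simpa only [iterPartial_zero] using hf
  | succ k ih =>
    intro p hp
    have h := (ih (Fin.tail i)).contDiffAt (hW.mem_nhds hp)
    have h2 : ContDiffAt ℝ ∞ (fun p : ℝ × (Fin m → ℝ) =>
        fderiv ℝ (_root_.iterPartial (Fin.tail i) (f p.1)) p.2) p := by
      refine ContDiffAt.fderiv (f := fun q : ℝ × (Fin m → ℝ) =>
        _root_.iterPartial (Fin.tail i) (f q.1)) (g := fun q => q.2) (n := ∞) ?_ contDiffAt_snd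
        (by simp)
      exact ContDiffAt.comp (p, p.2) (g := fun p : ℝ × (Fin m → ℝ) =>
        _root_.iterPartial (Fin.tail i) (f p.1) p.2) h
        ((contDiffAt_fst.comp _ contDiffAt_fst).prodMk contDiffAt_snd)
    have h3 : ContDiffAt ℝ ∞ (fun p : ℝ × (Fin m → ℝ) =>
        fderiv ℝ (_root_.iterPartial (Fin.tail i) (f p.1)) p.2 (Pi.single (i 0) 1)) p :=
      h2.clm_apply contDiffAt_const
    refine (h3.congr_of_eventuallyEq ?_).contDiffWithinAt
    filter_upwards [hW.mem_nhds hp] with q hq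
    exact iterPartial_succ _ ((hf.contDiffAt (hW.mem_nhds hq)).comp q.2
      (f := fun x => (q.1, x)) (g := fun p : ℝ × (Fin m → ℝ) => f p.1 p.2)
      (contDiffAt_const.prodMk contDiffAt_id))

/-- Every differentiation yields one factor `u` by the chain rule. Smoothness is assumed near `u •
x` so that the induction hypothesis holds near `x` and can itself be differentiated. -/
theorem iterPartial_comp_smul {k : ℕ} (i : Fin k → Fin m) {f : (Fin m → ℝ) → ℂ} {u : ℝ}
    {x : Fin m → ℝ} (hf : ∀ᶠ y in nhds (u • x), ContDiffAt ℝ ∞ f y) :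
    iterPartial i (fun y => f (u • y)) x = (u : ℂ) ^ k * iterPartial i f (u • x) := by
  induction k generalizing x with
  | zero => simp [iterPartial_zero]
  | succ k ih =>
    have hsm : ContDiff ℝ ∞ (fun y : Fin m → ℝ => u • y) := contDiff_const_smul u
    rw [iterPartial_succ (f := fun y => f (u • y)) i (hf.self_of_nhds.comp x hsm.contDiffAt),
      iterPartial_succ i hf.self_of_nhds]
    have hev : ∀ᶠ y in nhds x, ∀ᶠ z in nhds (u • y), ContDiffAt ℝ ∞ f z :=
      hsm.continuous.continuousAt.eventually hf.eventually_nhds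
    have : iterPartial (Fin.tail i) (fun y => f (u • y)) =ᶠ[nhds x]
        fun y => (u : ℂ) ^ k * iterPartial (Fin.tail i) f (u • y) := by
      filter_upwards [hev] with y hy using ih _ hy
    rw [this.fderiv_eq]
    have hd : DifferentiableAt ℝ (iterPartial (Fin.tail i) f) (u • x) :=
      (hf.self_of_nhds.iterPartial _).differentiableAt (by simp)
    have h4 : HasFDerivAt (fun y => (u : ℂ) ^ k * iterPartial (Fin.tail i) f (u • y)) _ x :=
      (HasFDerivAt.comp (f := fun y : Fin m → ℝ => u • y) x hd.hasFDerivAt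
        ((hasFDerivAt_id x).const_smul u)).const_mul ((u : ℂ) ^ k)
    rw [h4.fderiv]
    rw [_root_.smul_apply, ContinuousLinearMap.comp_apply, _root_.smul_apply,
      ContinuousLinearMap.id_apply, map_smul, Complex.real_smul, smul_eq_mul]
    ring

end IterPartial

/-! ### Density of the polynomials in `C^∞(V)` -/

section Density

open Filter Topology Convolution ContinuousLinearMap Pointwise

variable {m : ℕ}

theorem HasCompactSupport.iterPartial {k : ℕ} (i : Fin k → Fin m) {g : (Fin m → ℝ) → ℂ}
    (hg : HasCompactSupport g) : HasCompactSupport (iterPartial i g) :=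
  (hg.iteratedFDeriv (𝕜 := ℝ) k).comp_left
    (g := fun L : ContinuousMultilinearMap ℝ (fun _ : Fin k => Fin m → ℝ) ℂ =>
      L fun l => Pi.single (i l) 1) rfl

theorem ContDiff.iterPartial {k : ℕ} (i : Fin k → Fin m) {g : (Fin m → ℝ) → ℂ}
    (hg : ContDiff ℝ ∞ g) : ContDiff ℝ ∞ (iterPartial i g) :=
  contDiff_iff_contDiffAt.2 fun _ => hg.contDiffAt.iterPartial i

/-- All derivatives are thrown onto `g`, so a single kernel can serve all derivatives of `g` at
once. -/
theorem iterPartial_convolution {k : ℕ} (i : Fin k → Fin m) {κ : (Fin m → ℝ) → ℝ}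
    {g : (Fin m → ℝ) → ℂ} (hκ : Continuous κ) (hg : ContDiff ℝ ∞ g) (hgc : HasCompactSupport g) :
    iterPartial i (κ ⋆[lsmul ℝ ℝ, volume] g) = κ ⋆[lsmul ℝ ℝ, volume] iterPartial i g := by
  induction k with
  | zero => simp [iterPartial_zero]
  | succ k ih =>
    ext x
    have hl : LocallyIntegrable κ := hκ.locallyIntegrable
    have hc : ContDiff ℝ ∞ (κ ⋆[lsmul ℝ ℝ, volume] g : (Fin m → ℝ) → ℂ) :=
      hgc.contDiff_convolution_right (lsmul ℝ ℝ) hl hg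
    have hg1 := hg.iterPartial (Fin.tail i)
    have hgc1 := hgc.iterPartial (Fin.tail i)
    rw [iterPartial_succ i hc.contDiffAt, ih,
      (hgc1.hasFDerivAt_convolution_right (lsmul ℝ ℝ) hl
        (hg1.of_le (by exact_mod_cast le_top)) x).fderiv,
      convolution_precompR_apply _ hl (hgc1.fderiv ℝ)
        (hg1.continuous_fderiv (by simp))]
    congr 1
    ext y
    rw [iterPartial_succ i hg.contDiffAt]

theorem integrable_smul_comp_sub_left {q : (Fin m → ℝ) → ℝ} (hq : Continuous q)
    {h : (Fin m → ℝ) → ℂ} (hh : Continuous h) (hhc : HasCompactSupport h) (x : Fin m → ℝ) :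
    Integrable fun t => q t • h (x - t) :=
  (hq.smul (hh.comp (continuous_const.sub continuous_id))).integrable_of_hasCompactSupport
    (HasCompactSupport.smul_left (hhc.comp_homeomorph (Homeomorph.subLeft x)))

/-- Induction on `κ` for all `g` simultaneously: since `t_j = x_j - (x - t)_j`, a factor `X_j` in
the kernel becomes `x_j` outside the integral minus a convolution with `y ↦ y_j g(y)`. -/
theorem exists_mvPolynomial_convolution (κ : MvPolynomial (Fin m) ℝ) {g : (Fin m → ℝ) → ℂ}
    (hg : Continuous g) (hgc : HasCompactSupport g) :
    ∃ p : MvPolynomial (Fin m) ℂ, ∀ x : Fin m → ℝ,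
      ((fun t => MvPolynomial.eval t κ) ⋆[lsmul ℝ ℝ, volume] g) x
        = MvPolynomial.eval (fun j => (x j : ℂ)) p := by
  simp only [convolution_lsmul]
  induction κ using MvPolynomial.induction_on generalizing g with
  | C c =>
    refine ⟨MvPolynomial.C (c • ∫ t, g t), fun x => ?_⟩
    simp only [MvPolynomial.eval_C]
    rw [integral_smul, integral_sub_left_eq_self]
  | add p q hp hq =>
    obtain ⟨P, hP⟩ := hp hg hgc
    obtain ⟨Q, hQ⟩ := hq hg hgc
    refine ⟨P + Q, fun x => ?_⟩
    simp only [map_add, add_smul]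
    rw [integral_add (integrable_smul_comp_sub_left (MvPolynomial.continuous_eval p) hg hgc x)
      (integrable_smul_comp_sub_left (MvPolynomial.continuous_eval q) hg hgc x), hP, hQ]
  | mul_X p j hp =>
    have hg1 : Continuous fun y : Fin m → ℝ => y j • g y := (continuous_apply j).smul hg
    have hgc1 : HasCompactSupport fun y : Fin m → ℝ => y j • g y :=
      hgc.mono fun y hy h0 => hy (by simp only [h0, smul_zero])
    obtain ⟨P, hP⟩ := hp hg hgc
    obtain ⟨Q, hQ⟩ := hp hg1 hgc1
    refine ⟨MvPolynomial.X j * P - Q, fun x => ?_⟩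
    simp only [map_sub, map_mul, MvPolynomial.eval_X]
    have hi : Integrable fun t => x j • (MvPolynomial.eval t p • g (x - t)) :=
      (integrable_smul_comp_sub_left (MvPolynomial.continuous_eval p) hg hgc x).smul (x j)
    rw [← hP, ← hQ, ← smul_eq_mul (x j : ℂ), Complex.coe_smul, ← integral_smul,
      ← integral_sub hi
        (integrable_smul_comp_sub_left (MvPolynomial.continuous_eval p) hg1 hgc1 x)]
    congr 1
    ext t
    simp only [Pi.sub_apply, Complex.real_smul]
    push_cast
    ring

/-- Stone–Weierstrass: the coordinate functions separate points. -/
theorem exists_mvPolynomial_near {K : Set (Fin m → ℝ)} (hK : IsCompact K) {φ : (Fin m → ℝ) → ℝ}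
    (hφ : Continuous φ) {ε : ℝ} (hε : 0 < ε) :
    ∃ κ : MvPolynomial (Fin m) ℝ, ∀ x ∈ K, ‖MvPolynomial.eval x κ - φ x‖ < ε := by
  let c : Fin m → C(Fin m → ℝ, ℝ) := fun j => ⟨fun x => x j, continuous_apply j⟩
  have hev : ∀ (q : MvPolynomial (Fin m) ℝ) x, MvPolynomial.aeval c q x
      = MvPolynomial.eval x q := by
    intro q x
    have : ((ContinuousMap.evalAlgHom ℝ ℝ x).comp (MvPolynomial.aeval c))
        = MvPolynomial.aeval x := by
      ext j; simp [c]
    simpa [MvPolynomial.aeval_eq_eval] using DFunLike.congr_fun this q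
  have hsep : (MvPolynomial.aeval c : MvPolynomial (Fin m) ℝ →ₐ[ℝ] _).range.SeparatesPoints := by
    intro x y hxy
    obtain ⟨j, hj⟩ := Function.ne_iff.1 hxy
    exact ⟨c j, ⟨c j, ⟨MvPolynomial.X j, by simp⟩, rfl⟩, hj⟩
  obtain ⟨_, ⟨κ, rfl⟩, h⟩ :=
    ContinuousMap.exists_mem_subalgebra_near_continuous_of_isCompact_of_separatesPoints hsep
      ⟨φ, hφ⟩ hK hε
  exact ⟨κ, fun x hx => by simpa [hev] using h x hx⟩

/-- Simultaneous approximation of finitely many functions by the convolution with a polynomial. -/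
theorem exists_mvPolynomial_convolution_near {ι : Type*} [Finite ι] {h : ι → (Fin m → ℝ) → ℂ}
    (hh : ∀ a, Continuous (h a)) {S : Set (Fin m → ℝ)} (hS : IsCompact S)
    (hhS : ∀ a, ∀ x ∉ S, h a x = 0) {K : Set (Fin m → ℝ)} (hK : IsCompact K) {ε : ℝ}
    (hε : 0 < ε) :
    ∃ κ : MvPolynomial (Fin m) ℝ, ∀ a, ∀ x ∈ K,
      ‖((fun t => MvPolynomial.eval t κ) ⋆[lsmul ℝ ℝ, volume] h a) x - h a x‖ ≤ ε := by
  have hcs : ∀ a, HasCompactSupport (h a) := fun a => HasCompactSupport.intro hS (hhS a)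
  have huc : ∀ a, ∃ δ > 0, ∀ x y, dist x y < δ → dist (h a x) (h a y) < ε / 2 := fun a =>
    Metric.uniformContinuous_iff.1 ((hcs a).uniformContinuous_of_continuous (hh a)) _ (by positivity)
  have : ∃ δ > 0, ∀ a x y, dist x y < δ → dist (h a x) (h a y) < ε / 2 := by
    have : ∀ a, ∀ᶠ δ in 𝓝[>] (0 : ℝ), ∀ x y, dist x y < δ → dist (h a x) (h a y) < ε / 2 := by
      intro a
      obtain ⟨δ, hδ, H⟩ := huc a
      filter_upwards [Ioo_mem_nhdsGT hδ] with d hd x y hxy using H x y (hxy.trans hd.2)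
    obtain ⟨δ, h1, h2⟩ := ((eventually_all.2 this).and self_mem_nhdsWithin).exists
    exact ⟨δ, h2, h1⟩
  obtain ⟨δ, hδ, hδh⟩ := this
  let φ : ContDiffBump (0 : Fin m → ℝ) := ⟨δ / 2, δ, by positivity, by linarith⟩
  obtain ⟨M, hM⟩ : ∃ M, ∀ a, ∫ x, ‖h a x‖ ≤ M := by
    obtain ⟨M, hM⟩ := (Set.finite_range fun a => ∫ x, ‖h a x‖).bddAbove
    exact ⟨M, fun a => hM ⟨a, rfl⟩⟩
  have hφc : Continuous (φ.normed volume) := φ.continuous_normed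
  -- For `x ∈ K` only those `t` with `x - t ∈ S` contribute, so the polynomial need approximate the
  -- bump only on the compact set `K - S`. The error is integrated against `h a`, whose `L¹` norm is
  -- at most `M`.
  obtain ⟨κ, hκ⟩ := exists_mvPolynomial_near (K := (fun p : (Fin m → ℝ) × (Fin m → ℝ) => p.1 - p.2) '' K ×ˢ S)
    ((hK.prod hS).image continuous_sub) hφc
    (ε := ε / 2 / (|M| + 1)) (by positivity)
  refine ⟨κ, fun a x hx => ?_⟩
  have h1 : ‖(φ.normed volume ⋆[lsmul ℝ ℝ, volume] h a) x - h a x‖ ≤ ε / 2 := by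
    rw [← dist_eq_norm]
    refine φ.dist_normed_convolution_le (hh a).aestronglyMeasurable fun y hy => (hδh a _ _ ?_).le
    exact hy
  have h2 : ‖((fun t => MvPolynomial.eval t κ) ⋆[lsmul ℝ ℝ, volume] h a) x
      - (φ.normed volume ⋆[lsmul ℝ ℝ, volume] h a) x‖ ≤ ε / 2 := by
    have i1 := (hcs a).convolutionExists_right (lsmul ℝ ℝ)
      (MvPolynomial.continuous_eval κ).locallyIntegrable (μ := volume) (hh a) x
    have i2 := (hcs a).convolutionExists_right (lsmul ℝ ℝ)
      hφc.locallyIntegrable (μ := volume) (hh a) x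
    rw [convolution_def, convolution_def, ← integral_sub i1 i2]
    have hb : ∀ t, ‖(lsmul ℝ ℝ) (MvPolynomial.eval t κ) (h a (x - t))
        - (lsmul ℝ ℝ) (φ.normed volume t) (h a (x - t))‖
        ≤ ε / 2 / (|M| + 1) * ‖h a (x - t)‖ := by
      intro t
      by_cases ht : x - t ∈ S
      · have := hκ t ⟨(x, x - t), ⟨hx, ht⟩, by simp⟩
        simp only [lsmul_apply, ← sub_smul, norm_smul]
        exact mul_le_mul_of_nonneg_right this.le (norm_nonneg _)
      · simp [hhS a _ ht]
    have hi : Integrable fun t => ‖h a (x - t)‖ :=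
      (((hh a).integrable_of_hasCompactSupport (hcs a)).comp_sub_left x).norm
    refine (norm_integral_le_of_norm_le (hi.const_mul _) (Eventually.of_forall hb)).trans ?_
    rw [integral_const_mul, integral_sub_left_eq_self (fun t => ‖h a t‖)]
    have : ∫ t, ‖h a t‖ ≤ |M| + 1 := (hM a).trans ((le_abs_self M).trans (by simp))
    calc ε / 2 / (|M| + 1) * ∫ t, ‖h a t‖ ≤ ε / 2 / (|M| + 1) * (|M| + 1) :=
          mul_le_mul_of_nonneg_left this (by positivity)
      _ = ε / 2 := by field_simp
  calc _ = ‖(((fun t => MvPolynomial.eval t κ) ⋆[lsmul ℝ ℝ, volume] h a) x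
      - (φ.normed volume ⋆[lsmul ℝ ℝ, volume] h a) x) +
      ((φ.normed volume ⋆[lsmul ℝ ℝ, volume] h a) x - h a x)‖ := by rw [sub_add_sub_cancel]
    _ ≤ ε / 2 + ε / 2 := norm_add_le_of_le h2 h1
    _ = ε := by ring

theorem contDiff_mvPolynomial_eval (p : MvPolynomial (Fin m) ℂ) :
    ContDiff ℝ ∞ fun x : Fin m → ℝ => MvPolynomial.eval (fun j => (x j : ℂ)) p := by
  induction p using MvPolynomial.induction_on with
  | C c => simpa using contDiff_const
  | add p q hp hq => simpa using hp.add hq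
  | mul_X p j hp =>
    simpa using hp.mul (Complex.ofRealCLM.contDiff.comp (contDiff_apply ℝ ℝ j))

/-- A smooth cutoff function of a compact set in an open set. -/
theorem exists_contDiff_cutoff {E : Type*} [NormedAddCommGroup E] [NormedSpace ℝ E]
    [FiniteDimensional ℝ E] {K V : Set E} (hK : IsCompact K) (hV : IsOpen V) (hKV : K ⊆ V) :
    ∃ χ : E → ℝ, ContDiff ℝ ∞ χ ∧ HasCompactSupport χ ∧ tsupport χ ⊆ V ∧
      ∀ x ∈ K, χ =ᶠ[𝓝 x] 1 := by
  obtain ⟨L, hL, hKL, hLV⟩ := exists_compact_between hK hV hKV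
  obtain ⟨χ, h1, h0, -⟩ := exists_contMDiffMap_one_nhds_of_subset_interior (n := (⊤ : ℕ∞))
    (modelWithCornersSelf ℝ E) hK.isClosed hKL
  have hs : tsupport χ ⊆ L := closure_minimal
    (fun x hx => by_contra fun hxL => hx (h0 x hxL)) hL.isClosed
  refine ⟨χ, χ.contMDiff.contDiff, HasCompactSupport.intro hL h0, hs.trans hLV, fun x hx => ?_⟩
  exact h1.filter_mono (nhds_le_nhdsSet hx)

/-- Off the closed support of `χ` the product vanishes locally; on it `f` is smooth. -/
theorem contDiff_mul_cutoff {V : Set (Fin m → ℝ)} (hV : IsOpen V) {f χ : (Fin m → ℝ) → ℂ}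
    (hf : ContDiffOn ℝ ∞ f V) (hχ : ContDiff ℝ ∞ χ) (hs : tsupport χ ⊆ V) :
    ContDiff ℝ ∞ (χ * f) := by
  refine contDiff_iff_contDiffAt.2 fun x => ?_
  by_cases hx : x ∈ tsupport (χ * f)
  swap
  · exact contDiffAt_const.congr_of_eventuallyEq (notMem_tsupport_iff_eventuallyEq.1 hx)
  have hx' : x ∈ tsupport χ := closure_mono (Function.support_mul_subset_left _ _) hx
  exact hχ.contDiffAt.mul (hf.contDiffAt (hV.mem_nhds (hs hx')))

theorem exists_mvPolynomial_near_smooth {V : Set (Fin m → ℝ)} (hV : IsOpen V)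
    {K : Set (Fin m → ℝ)} (hK : IsCompact K) (hKV : K ⊆ V) {f : (Fin m → ℝ) → ℂ}
    (hf : ContDiffOn ℝ ∞ f V) (N : ℕ) {ε : ℝ} (hε : 0 < ε) :
    ∃ p : MvPolynomial (Fin m) ℂ, ∀ k ≤ N, ∀ x ∈ K,
      ‖iteratedFDeriv ℝ k (fun y => f y - MvPolynomial.eval (fun j => (y j : ℂ)) p) x‖ ≤ ε := by
  obtain ⟨χ, hχ, hχc, hχs, hχ1⟩ := exists_contDiff_cutoff hK hV hKV
  let χ' : (Fin m → ℝ) → ℂ := fun x => (χ x : ℂ)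
  have hχ' : ContDiff ℝ ∞ χ' := Complex.ofRealCLM.contDiff.comp hχ
  have hsub : tsupport χ' ⊆ tsupport χ := by
    refine closure_mono fun x hx hx0 => hx ?_
    simp [χ', hx0]
  set g : (Fin m → ℝ) → ℂ := χ' * f with hgdef
  have hg : ContDiff ℝ ∞ g := contDiff_mul_cutoff hV hf hχ' (hsub.trans hχs)
  have hgs : tsupport g ⊆ tsupport χ :=
    (closure_mono (Function.support_mul_subset_left _ _)).trans hsub
  have hgc : HasCompactSupport g := hχc.of_isClosed_subset isClosed_closure hgs
  let ι := Σ k : Fin (N + 1), Fin k → Fin m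
  let h : ι → (Fin m → ℝ) → ℂ := fun a => iterPartial a.2 g
  set c : ℝ := (Fintype.card ι : ℝ)
  -- The index type consists of all words of length at most `N`, so `c` bounds the number of partial
  -- derivatives of any one order, and `ε / (c + 1)` for each of them suffices.
  obtain ⟨κ, hκ⟩ := exists_mvPolynomial_convolution_near (h := h)
    (fun a => (hg.iterPartial a.2).continuous) (S := tsupport g) hgc (fun a x hx => by
      have : g =ᶠ[𝓝 x] 0 := notMem_tsupport_iff_eventuallyEq.1 hx
      change iterPartial a.2 g x = 0
      rw [this.iterPartial_eq, iterPartial]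
      simp) hK (ε := ε / (c + 1)) (by positivity)
  obtain ⟨p, hp⟩ := exists_mvPolynomial_convolution κ hg.continuous hgc
  refine ⟨p, fun k hk x hx => ?_⟩
  have hfg : (fun y => f y - MvPolynomial.eval (fun j => (y j : ℂ)) p) =ᶠ[𝓝 x]
      g + (-1 : ℂ) • fun y => MvPolynomial.eval (fun j => (y j : ℂ)) p := by
    filter_upwards [hχ1 x hx] with y hy
    simp [g, χ', hy, sub_eq_add_neg]
  rw [(hfg.iteratedFDeriv ℝ k).eq_of_nhds]
  refine (norm_iteratedFDeriv_le_sum k _ x).trans ?_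
  have hterm : ∀ i : Fin k → Fin m, ‖iterPartial i
      (g + (-1 : ℂ) • fun y => MvPolynomial.eval (fun j => (y j : ℂ)) p) x‖ ≤ ε / (c + 1) := by
    intro i
    rw [iterPartial_add i hg.contDiffAt
      (g := (-1 : ℂ) • fun y => MvPolynomial.eval (fun j => (y j : ℂ)) p)
      ((contDiff_mvPolynomial_eval p).contDiffAt.const_smul (-1 : ℂ)), iterPartial_const_smul i _
      (contDiff_mvPolynomial_eval p).contDiffAt, ← funext hp,
      iterPartial_convolution i (MvPolynomial.continuous_eval κ) hg hgc, neg_one_smul,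
      ← sub_eq_add_neg, norm_sub_rev]
    exact hκ ⟨⟨k, by omega⟩, i⟩ x hx
  refine (Finset.sum_le_sum fun i _ => hterm i).trans ?_
  have hcard : (Fintype.card (Fin k → Fin m) : ℝ) ≤ c := by
    refine Nat.cast_le.2 (Fintype.card_le_of_injective
      (fun i => (⟨⟨k, by omega⟩, i⟩ : ι)) fun i j hij => ?_)
    exact eq_of_heq (Sigma.mk.inj hij).2
  rw [Finset.sum_const, Finset.card_univ, nsmul_eq_mul]
  calc _ ≤ c * (ε / (c + 1)) := mul_le_mul_of_nonneg_right hcard (by positivity)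
    _ ≤ ε := by
      rw [← mul_div_assoc, div_le_iff₀ (by positivity)]
      nlinarith

end Density

/-! ### Uniqueness and transport of the smooth functional calculus -/

section SmoothCalculusLemmas

variable {m : ℕ} {B : Type*} [NormedRing B] [NormedAlgebra ℂ B] {V : Set (Fin m → ℝ)}
  {b : Fin m → B} {Φ Ψ : smoothAlg V →ₐ[ℂ] B}

/-- The polynomial functions as elements of `C^∞(V)`. -/
noncomputable def smoothPoly (V : Set (Fin m → ℝ)) : MvPolynomial (Fin m) ℂ →ₐ[ℂ] smoothAlg V :=
  MvPolynomial.aeval (smoothCoord V)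

theorem coe_smoothPoly (p : MvPolynomial (Fin m) ℂ) :
    (smoothPoly V p : (Fin m → ℝ) → ℂ) = fun x => MvPolynomial.eval (fun j => (x j : ℂ)) p := by
  ext x
  have : ((Pi.evalAlgHom ℂ (fun _ : Fin m → ℝ => ℂ) x).comp (smoothAlg V).val).comp (smoothPoly V)
      = MvPolynomial.aeval fun j => (x j : ℂ) := by
    ext j; simp [smoothPoly, smoothCoord]
  simpa [MvPolynomial.aeval_eq_eval] using DFunLike.congr_fun this p

theorem exists_smoothPoly_near (hV : IsOpen V) {K : Set (Fin m → ℝ)} (hK : IsCompact K)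
    (hKV : K ⊆ V) (f : smoothAlg V) (N : ℕ) {ε : ℝ} (hε : 0 < ε) :
    ∃ p : MvPolynomial (Fin m) ℂ, ∀ k ≤ N, ∀ x ∈ K,
      ‖iteratedFDeriv ℝ k ((f - smoothPoly V p : smoothAlg V) : (Fin m → ℝ) → ℂ) x‖ ≤ ε := by
  obtain ⟨p, hp⟩ := exists_mvPolynomial_near_smooth hV hK hKV f.2 N hε
  refine ⟨p, fun k hk x hx => ?_⟩
  have : ((f - smoothPoly V p : smoothAlg V) : (Fin m → ℝ) → ℂ)
      = fun y => (f : (Fin m → ℝ) → ℂ) y - MvPolynomial.eval (fun j => (y j : ℂ)) p := by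
    ext y
    simp [coe_smoothPoly]
  rw [this]
  exact hp k hk x hx

/-- Continuity of a linear map on `C^∞(V)` for the Fréchet topology. -/
def SmoothBounded (L : smoothAlg V →ₗ[ℂ] B) : Prop :=
  ∃ K : Set (Fin m → ℝ), IsCompact K ∧ K ⊆ V ∧ ∃ (N : ℕ) (C : ℝ),
    ∀ (f : smoothAlg V) (M : ℝ), 0 ≤ M →
      (∀ k ≤ N, ∀ x ∈ K, ‖iteratedFDeriv ℝ k (f : (Fin m → ℝ) → ℂ) x‖ ≤ M) → ‖L f‖ ≤ C * M

theorem SmoothBounded.sub {L L' : smoothAlg V →ₗ[ℂ] B} (h : SmoothBounded L)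
    (h' : SmoothBounded L') : SmoothBounded (L - L') := by
  obtain ⟨K, hK, hKV, N, C, hC⟩ := h
  obtain ⟨K', hK', hKV', N', C', hC'⟩ := h'
  refine ⟨K ∪ K', hK.union hK', union_subset hKV hKV', max N N', C + C', fun f M hM hf => ?_⟩
  rw [add_mul]
  exact (norm_sub_le _ _).trans (add_le_add
    (hC f M hM fun k hk x hx => hf k (hk.trans (le_max_left _ _)) x (Or.inl hx))
    (hC' f M hM fun k hk x hx => hf k (hk.trans (le_max_right _ _)) x (Or.inr hx)))

theorem SmoothBounded.clm_comp {B' : Type*} [NormedRing B'] [NormedAlgebra ℂ B']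
    {L : smoothAlg V →ₗ[ℂ] B} (h : SmoothBounded L) (T : B →L[ℂ] B') :
    SmoothBounded ((T : B →ₗ[ℂ] B') ∘ₗ L) := by
  obtain ⟨K, hK, hKV, N, C, hC⟩ := h
  refine ⟨K, hK, hKV, N, ‖T‖ * C, fun f M hM hf => ?_⟩
  rw [mul_assoc]
  exact (T.le_opNorm _).trans (mul_le_mul_of_nonneg_left (hC f M hM hf) (norm_nonneg _))

/-- Bounds of the derivatives of a product, uniformly on a compact set. -/
theorem exists_norm_iteratedFDeriv_mul_le (hV : IsOpen V) {g : (Fin m → ℝ) → ℂ}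
    (hg : ContDiffOn ℝ ∞ g V) {K : Set (Fin m → ℝ)} (hK : IsCompact K) (hKV : K ⊆ V) (N : ℕ) :
    ∃ C, 0 ≤ C ∧ ∀ (f : (Fin m → ℝ) → ℂ), ContDiffOn ℝ ∞ f V → ∀ M : ℝ, ∀ x ∈ K,
      (∀ k ≤ N, ‖iteratedFDeriv ℝ k f x‖ ≤ M) →
        ∀ k ≤ N, ‖iteratedFDeriv ℝ k (g * f) x‖ ≤ C * M := by
  have hb : ∀ k, ∃ D, ∀ x ∈ K, ‖iteratedFDeriv ℝ k g x‖ ≤ D := by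
    intro k
    refine hK.exists_bound_of_continuousOn (fun x hx => ?_)
    exact ((hg.contDiffAt (hV.mem_nhds (hKV hx))).iteratedFDeriv_right (m := 0) (i := k)
      (by rw [zero_add]; exact_mod_cast le_top)).continuousAt.continuousWithinAt
  choose D hD using hb
  -- The Leibniz constants of all orders up to `N` are added, so that one constant serves every `k ≤
  -- N`.
  refine ⟨∑ k ∈ Finset.range (N + 1), ∑ i ∈ Finset.range (k + 1), (k.choose i : ℝ) * |D i|,
    by positivity, fun f hf M x hx hM k hk => ?_⟩
  have hxV := hKV hx
  have hM0 : 0 ≤ M := (norm_nonneg _).trans (hM 0 (Nat.zero_le _))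
  have h := norm_iteratedFDerivWithin_mul_le (n := k) hg hf hV.uniqueDiffOn hxV (N := ∞)
    (by exact_mod_cast le_top)
  simp only [iteratedFDerivWithin_of_isOpen _ hV hxV] at h
  refine h.trans ?_
  have h1 : ∑ i ∈ Finset.range (k + 1), (k.choose i : ℝ) * ‖iteratedFDeriv ℝ i g x‖
      * ‖iteratedFDeriv ℝ (k - i) f x‖ ≤
      (∑ i ∈ Finset.range (k + 1), (k.choose i : ℝ) * |D i|) * M := by
    rw [Finset.sum_mul]
    refine Finset.sum_le_sum fun i _ => ?_
    have h2 := (hD i x hx).trans (le_abs_self _)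
    have h3 := hM (k - i) (by omega)
    gcongr
  refine h1.trans (mul_le_mul_of_nonneg_right ?_ hM0)
  exact Finset.single_le_sum
    (f := fun k => ∑ i ∈ Finset.range (k + 1), (k.choose i : ℝ) * |D i|)
    (fun _ _ => by positivity) (Finset.mem_range.2 (Nat.lt_succ_of_le hk))

theorem SmoothBounded.comp_mulLeft (hV : IsOpen V) {L : smoothAlg V →ₗ[ℂ] B}
    (h : SmoothBounded L) (g : smoothAlg V) : SmoothBounded (L ∘ₗ LinearMap.mulLeft ℂ g) := by
  obtain ⟨K, hK, hKV, N, C, hC⟩ := h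
  obtain ⟨D, hD0, hD⟩ := exists_norm_iteratedFDeriv_mul_le hV g.2 hK hKV N
  refine ⟨K, hK, hKV, N, C * D, fun f M hM hf => ?_⟩
  rw [mul_assoc]
  exact hC (g * f) (D * M) (by positivity) fun k hk x hx =>
    hD f f.2 M x hx (fun l hl => hf l hl x hx) k hk

theorem SmoothBounded.eq_zero (hV : IsOpen V) {L : smoothAlg V →ₗ[ℂ] B} (h : SmoothBounded L)
    (hp : ∀ p, L (smoothPoly V p) = 0) : L = 0 := by
  obtain ⟨K, hK, hKV, N, C, hC⟩ := h
  ext f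
  rw [LinearMap.zero_apply, ← norm_le_zero_iff]
  refine le_of_forall_pos_le_add fun ε hε => ?_
  -- The constant `C` has no sign; `|C| + 1` is positive and dominates it.
  have hδ : 0 < ε / (|C| + 1) := by positivity
  obtain ⟨p, hpn⟩ := exists_smoothPoly_near hV hK hKV f N hδ
  have h1 := hC _ _ hδ.le hpn
  rw [map_sub, hp, sub_zero] at h1
  rw [zero_add]
  calc _ ≤ C * (ε / (|C| + 1)) := h1
    _ ≤ (|C| + 1) * (ε / (|C| + 1)) :=
      mul_le_mul_of_nonneg_right ((le_abs_self C).trans (by simp)) hδ.le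
    _ = ε := by field_simp

/-- Density is used once in each argument: first in `g` with a polynomial fixed on the left, then in
`f` with an arbitrary `g` fixed. -/
theorem SmoothBounded.map_mul (hV : IsOpen V) {L : smoothAlg V →ₗ[ℂ] B} (h : SmoothBounded L)
    (hp : ∀ p q, L (smoothPoly V (p * q)) = L (smoothPoly V p) * L (smoothPoly V q))
    (f g : smoothAlg V) : L (f * g) = L f * L g := by
  have h1 : ∀ p g, L (smoothPoly V p * g) = L (smoothPoly V p) * L g := fun p g => by
    have := ((h.comp_mulLeft hV (smoothPoly V p)).sub
      (h.clm_comp (ContinuousLinearMap.mul ℂ B (L (smoothPoly V p))))).eq_zero hV fun q => by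
        simp [← hp]
    simpa [sub_eq_zero] using DFunLike.congr_fun this g
  have := ((h.comp_mulLeft hV g).sub
    (h.clm_comp ((ContinuousLinearMap.mul ℂ B).flip (L g)))).eq_zero hV fun q => by
      simp [mul_comm g, h1]
  simpa [sub_eq_zero, mul_comm g] using DFunLike.congr_fun this f

theorem IsSmoothCalculus.unique (hV : IsOpen V) (hΦ : IsSmoothCalculus V b Φ)
    (hΨ : IsSmoothCalculus V b Ψ) : Φ = Ψ := by
  have hpoly : Φ.comp (smoothPoly V) = Ψ.comp (smoothPoly V) := by
    ext j; simp [smoothPoly, hΦ.map_coord, hΨ.map_coord]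
  have h : SmoothBounded (Φ.toLinearMap - Ψ.toLinearMap) :=
    SmoothBounded.sub hΦ.continuous hΨ.continuous
  ext f
  simpa [sub_eq_zero] using DFunLike.congr_fun
    (h.eq_zero hV fun p => sub_eq_zero.2 (DFunLike.congr_fun hpoly p)) f

theorem IsSmoothCalculus.hasSmoothCalculus (hV : IsOpen V) (hΦ : IsSmoothCalculus V b Φ) :
    HasSmoothCalculus V b :=
  ⟨Φ, hΦ, fun _ h => h.unique hV hΦ⟩

theorem IsSmoothCalculus.smoothCalc_eq (hV : IsOpen V) (hΦ : IsSmoothCalculus V b Φ)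
    {f : (Fin m → ℝ) → ℂ} (hf : ContDiffOn ℝ ∞ f V) : smoothCalc V f b = Φ ⟨f, hf⟩ := by
  have h : (∃ Φ : smoothAlg V →ₐ[ℂ] B, IsSmoothCalculus V b Φ) ∧ f ∈ smoothAlg V := ⟨⟨Φ, hΦ⟩, hf⟩
  rw [smoothCalc, dif_pos h, h.1.choose_spec.unique hV hΦ]

/-- Elements of `smoothAlg V` are total functions, so equality on `V` is weaker than equality. As
`V` is open, all derivatives of the difference vanish on `K`, and the continuity bound applies with
`M = 0`. -/
theorem IsSmoothCalculus.congr (hV : IsOpen V) (hΦ : IsSmoothCalculus V b Φ) {f g : smoothAlg V}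
    (h : EqOn (f : (Fin m → ℝ) → ℂ) g V) : Φ f = Φ g := by
  obtain ⟨K, hK, hKV, N, C, hC⟩ := hΦ.continuous
  rw [← sub_eq_zero, ← norm_le_zero_iff, ← map_sub, ← mul_zero C]
  refine hC _ 0 le_rfl fun k _ x hx => ?_
  have : ((f - g : smoothAlg V) : (Fin m → ℝ) → ℂ) =ᶠ[nhds x] fun _ => 0 := by
    filter_upwards [hV.mem_nhds (hKV hx)] with y hy
    simp [h hy]
  rw [(this.iteratedFDeriv ℝ k).eq_of_nhds, iteratedFDeriv_fun_zero]
  simp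

/-- Bounds of the derivatives of a composition, uniformly on a compact set. -/
theorem exists_norm_iteratedFDeriv_comp_le {m' : ℕ} (hV : IsOpen V) {V' : Set (Fin m' → ℝ)}
    (hV' : IsOpen V') {ρ : (Fin m → ℝ) → Fin m' → ℝ} (hρ : ContDiffOn ℝ ∞ ρ V)
    (hmaps : MapsTo ρ V V') {K : Set (Fin m → ℝ)} (hK : IsCompact K) (hKV : K ⊆ V) (N : ℕ) :
    ∃ C, 0 ≤ C ∧ ∀ (f : (Fin m' → ℝ) → ℂ), ContDiffOn ℝ ∞ f V' → ∀ M : ℝ, ∀ x ∈ K,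
      (∀ k ≤ N, ‖iteratedFDeriv ℝ k f (ρ x)‖ ≤ M) →
        ∀ k ≤ N, ‖iteratedFDeriv ℝ k (f ∘ ρ) x‖ ≤ C * M := by
  have hb : ∀ k, ∃ D, ∀ x ∈ K, ‖iteratedFDeriv ℝ k ρ x‖ ≤ D := by
    intro k
    refine hK.exists_bound_of_continuousOn (fun x hx => ?_)
    exact ((hρ.contDiffAt (hV.mem_nhds (hKV hx))).iteratedFDeriv_right (m := 0) (i := k)
      (by rw [zero_add]; exact_mod_cast le_top)).continuousAt.continuousWithinAt
  choose D hD using hb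
  -- The Faà di Bruno estimate asks for the bound `E ^ i` on the derivative of order `i ≥ 1` of `ρ`;
  -- because `1 ≤ E`, the uniform bound `E` is enough.
  set E := 1 + ∑ k ∈ Finset.range (N + 1), |D k|
  have hE : ∀ k ≤ N, D k ≤ E := fun k hk => by
    have := Finset.single_le_sum (f := fun k => |D k|) (fun _ _ => abs_nonneg _)
      (Finset.mem_range.2 (Nat.lt_succ_of_le hk))
    exact (le_abs_self _).trans (this.trans (by simp [E]))
  have hE1 : 1 ≤ E := by simp only [E]; linarith [Finset.sum_nonneg fun k (_ :
    k ∈ Finset.range (N + 1)) => abs_nonneg (D k)]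
  refine ⟨N.factorial * E ^ N, by positivity, fun f hf M x hx hM k hk => ?_⟩
  have hxV := hKV hx
  have hM0 : 0 ≤ M := (norm_nonneg _).trans (hM 0 (Nat.zero_le _))
  have h := norm_iteratedFDerivWithin_comp_le (n := k) (N := ∞) (C := M) (D := E) hf hρ
    (by exact_mod_cast le_top)
    hV'.uniqueDiffOn hV.uniqueDiffOn hmaps hxV (fun i hi => by
      rw [iteratedFDerivWithin_of_isOpen i hV' (hmaps hxV)]
      exact hM i (hi.trans hk)) (fun i hi1 hi => by
      rw [iteratedFDerivWithin_of_isOpen i hV hxV]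
      exact ((hD i x hx).trans (hE i (hi.trans hk))).trans
        (le_self_pow₀ hE1 (by omega)))
  rw [iteratedFDerivWithin_of_isOpen k hV hxV] at h
  refine h.trans ?_
  rw [mul_right_comm]
  gcongr

/-- Transport of a smooth functional calculus along a smooth map. -/
theorem IsSmoothCalculus.comp {m' : ℕ} (hV : IsOpen V) {V' : Set (Fin m' → ℝ)}
    (hV' : IsOpen V') {ρ : (Fin m → ℝ) → Fin m' → ℝ} (hρ : ContDiffOn ℝ ∞ ρ V)
    (hmaps : MapsTo ρ V V') (hΦ : IsSmoothCalculus V b Φ) {b' : Fin m' → B}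
    (hb' : ∀ j (hj : ContDiffOn ℝ ∞ (fun x => (ρ x j : ℂ)) V), Φ ⟨_, hj⟩ = b' j) :
    ∃ Ψ : smoothAlg V' →ₐ[ℂ] B, IsSmoothCalculus V' b' Ψ ∧
      ∀ f (hf : ContDiffOn ℝ ∞ f V') (hfρ : ContDiffOn ℝ ∞ (fun x => f (ρ x)) V),
        Ψ ⟨f, hf⟩ = Φ ⟨_, hfρ⟩ := by
  let R : smoothAlg V' →ₐ[ℂ] smoothAlg V :=
    { toFun := fun f => ⟨fun x => (f : (Fin m' → ℝ) → ℂ) (ρ x), f.2.comp hρ hmaps⟩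
      map_one' := rfl
      map_mul' := fun _ _ => rfl
      map_zero' := rfl
      map_add' := fun _ _ => rfl
      commutes' := fun _ => rfl }
  refine ⟨Φ.comp R, ⟨fun j => hb' j _, ?_⟩, fun f hf hfρ => rfl⟩
  obtain ⟨K, hK, hKV, N, C, hC⟩ := hΦ.continuous
  obtain ⟨D, hD0, hD⟩ := exists_norm_iteratedFDeriv_comp_le hV hV' hρ hmaps hK hKV N
  refine ⟨ρ '' K, hK.image_of_continuousOn (hρ.continuousOn.mono hKV),
    image_subset_iff.2 fun x hx => hmaps (hKV hx), N, C * D, fun f M hM h => ?_⟩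
  rw [mul_assoc]
  exact hC (R f) (D * M) (by positivity) fun k hk x hx =>
    hD f f.2 M x hx (fun l hl => h l hl _ (mem_image_of_mem _ hx)) k hk

end SmoothCalculusLemmas

/-! ### Multilinear Fubini and the one-dimensional kernel formula -/

section Kernel

open Filter Topology

/-- Split off the first variable by Fubini, use the induction hypothesis on the curried map, then
pull the last integral through a continuous linear map. For `m = 0` the measure is a unit point
mass. -/
theorem ContinuousMultilinearMap.integral_apply_pi {E F : Type*} [NormedAddCommGroup E]
    [NormedSpace ℂ E] [CompleteSpace E] [NormedAddCommGroup F] [NormedSpace ℂ F] [CompleteSpace F]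
    {m : ℕ} (M : ContinuousMultilinearMap ℂ (fun _ : Fin m => E) F) {v : Fin m → ℝ → E}
    (hv : ∀ j, Continuous (v j)) (hc : ∀ j, HasCompactSupport (v j)) :
    ∫ x : Fin m → ℝ, M (fun j => v j (x j)) = M fun j => ∫ t, v j t := by
  induction m with
  | zero =>
    have : ∀ x : Fin 0 → ℝ, M (fun j => v j (x j)) = M fun j => ∫ t, v j t := fun x => by
      congr 1; exact Subsingleton.elim _ _
    simp [this, measureReal_def, volume_pi]
  | succ m ih =>
    have hmp := (volume_preserving_piFinSuccAbove (fun _ : Fin (m + 1) => ℝ) 0).symm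
    rw [← hmp.integral_comp']
    have he : ∀ p : ℝ × (Fin m → ℝ), M (fun j => v j
        ((MeasurableEquiv.piFinSuccAbove (fun _ : Fin (m + 1) => ℝ) 0).symm p j))
        = M.curryLeft (v 0 p.1) fun j => v j.succ (p.2 j) := by
      intro p
      rw [ContinuousMultilinearMap.curryLeft_apply]
      congr 1
      ext j
      refine Fin.cases ?_ (fun i => ?_) j
      · simp [MeasurableEquiv.piFinSuccAbove]
      · simp [MeasurableEquiv.piFinSuccAbove]
    simp only [he]
    have hcont : Continuous fun p : ℝ × (Fin m → ℝ) =>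
        M.curryLeft (v 0 p.1) fun j => v j.succ (p.2 j) := by
      have : Continuous fun p : ℝ × (Fin m → ℝ) =>
          M (Fin.cons (v 0 p.1) fun j => v j.succ (p.2 j)) := by
        refine M.cont.comp (continuous_pi fun j => ?_)
        refine Fin.cases ?_ (fun i => ?_) j
        · exact (hv 0).comp continuous_fst
        · exact (hv i.succ).comp ((continuous_apply i).comp continuous_snd)
      exact this
    have hint : Integrable (fun p : ℝ × (Fin m → ℝ) =>
        M.curryLeft (v 0 p.1) fun j => v j.succ (p.2 j)) (volume.prod volume) := by
      refine hcont.integrable_of_hasCompactSupport (HasCompactSupport.intro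
        ((hc 0).isCompact.prod (isCompact_univ_pi fun j : Fin m => (hc j.succ).isCompact)) ?_)
      intro p hp
      by_cases h0 : p.1 ∈ tsupport (v 0)
      · have : ∃ j, p.2 j ∉ tsupport (v (Fin.succ j)) := by
          by_contra! h
          exact hp ⟨h0, fun j _ => h j⟩
        obtain ⟨j, hj⟩ := this
        exact (M.curryLeft (v 0 p.1)).map_coord_zero j (image_eq_zero_of_notMem_tsupport hj)
      · rw [image_eq_zero_of_notMem_tsupport h0]
        exact M.map_coord_zero 0 rfl
    rw [Measure.volume_eq_prod, integral_prod _ hint]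
    simp only [ih (M.curryLeft _) (fun j => hv j.succ) (fun j => hc j.succ)]
    have hL := ((ContinuousMultilinearMap.apply ℂ (fun _ : Fin m => E) F
      fun j => ∫ t, v j.succ t).comp M.curryLeft).integral_comp_comm
        ((hv 0).integrable_of_hasCompactSupport (μ := volume) (hc 0))
    refine hL.trans ?_
    change M (Fin.cons _ _) = _
    congr 1
    ext j
    refine Fin.cases ?_ (fun i => ?_) j <;> simp

/-- On `t ≤ l` the integrand is the derivative of `φ'(t)(l - t) + φ(t)`, which equals `φ(l)` at `t =
l` and vanishes near `-∞`. The second derivative is used because its kernel is continuous in `l`,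
hence admissible in the continuous functional calculus; the kernel for the first derivative is a
jump function. -/
theorem integral_iteratedDeriv_two_mul_max {φ : ℝ → ℝ} (hφ : ContDiff ℝ ∞ φ)
    (hc : HasCompactSupport φ) (l : ℝ) :
    ∫ t, iteratedDeriv 2 φ t * max (l - t) 0 = φ l := by
  let f : ℝ → ℝ := fun t => deriv φ t * (l - t) + φ t
  have hφ' : ContDiff ℝ ∞ (deriv φ) := (contDiff_infty_iff_deriv.1 hφ).2
  have hf : ContDiff ℝ 1 f :=
    ((hφ'.mul (contDiff_const.sub contDiff_id)).add hφ).of_le (by exact_mod_cast le_top)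
  have hfc : HasCompactSupport f := (hc.deriv.mul_right).add hc
  have hd : ∀ t, deriv f t = iteratedDeriv 2 φ t * (l - t) := by
    intro t
    have h1 : HasDerivAt φ (deriv φ t) t := (hφ.differentiable (by simp) t).hasDerivAt
    have h2 : HasDerivAt (deriv φ) (deriv (deriv φ) t) t :=
      (hφ'.differentiable (by simp) t).hasDerivAt
    have h3 := (h2.mul ((hasDerivAt_id t).const_sub l)).add h1
    refine (HasDerivAt.deriv h3).trans ?_
    rw [iteratedDeriv_succ, iteratedDeriv_one]
    simp
  have h := HasCompactSupport.integral_Iic_deriv_eq hf hfc l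
  rw [show f l = φ l by simp [f], ← integral_indicator measurableSet_Iic] at h
  rw [← h]
  congr 1
  ext t
  by_cases ht : t ≤ l
  · rw [indicator_of_mem (show t ∈ Iic l from ht), hd, max_eq_left (by linarith)]
  · rw [indicator_of_notMem (show t ∉ Iic l from ht), max_eq_right (by linarith), mul_zero]

variable {𝒜 : Type*} [CStarAlgebra 𝒜]

/-- The element `(A - t)₊`. -/
noncomputable def posPartSub (A : 𝒜) (t : ℝ) : 𝒜 := cfc (fun l : ℝ => max (l - t) 0) A

theorem continuous_posPartSub (A : 𝒜) : Continuous (posPartSub A) := by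
  refine LipschitzWith.continuous (K := 1) (LipschitzWith.of_dist_le_mul fun s t => ?_)
  rw [dist_eq_norm, posPartSub, posPartSub, ← cfc_sub (fun l : ℝ => max (l - s) 0)
    (fun l : ℝ => max (l - t) 0) A (by fun_prop) (by fun_prop)]
  refine norm_cfc_le (by positivity) fun l _ => ?_
  rw [NNReal.coe_one, one_mul, Real.norm_eq_abs]
  refine (abs_max_sub_max_le_abs _ _ _).trans ?_
  rw [Real.dist_eq, abs_sub_comm s t]
  exact (congrArg abs (by ring)).le

theorem integral_iteratedDeriv_two_smul_posPartSub {A : 𝒜} (hA : IsSelfAdjoint A) {φ : ℝ → ℝ}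
    (hφ : ContDiff ℝ ∞ φ) (hc : HasCompactSupport φ) :
    ∫ t, iteratedDeriv 2 φ t • posPartSub A t = cfc φ A := by
  have hφc : Continuous (iteratedDeriv 2 φ) :=
    hφ.continuous_iteratedDeriv 2 (by norm_cast)
  have hφs : HasCompactSupport (iteratedDeriv 2 φ) := by
    rw [iteratedDeriv_succ, iteratedDeriv_one]
    exact hc.deriv.deriv
  have hbc : Continuous fun t => ‖iteratedDeriv 2 φ t‖ * (‖A‖ + |t|) := by fun_prop
  have hb : Integrable fun t => ‖iteratedDeriv 2 φ t‖ * (‖A‖ + |t|) :=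
    hbc.integrable_of_hasCompactSupport hφs.norm.mul_right
  have h := cfc_integral (𝕜 := ℝ) (μ := volume) (fun t l => iteratedDeriv 2 φ t * max (l - t) 0)
    (fun t => ‖iteratedDeriv 2 φ t‖ * (‖A‖ + |t|)) A (by fun_prop) ?_ hb.hasFiniteIntegral hA
  · simp only [integral_iteratedDeriv_two_mul_max hφ hc] at h
    rw [h]
    congr 1
    ext t
    rw [posPartSub, ← cfc_smul _ _ _ (by fun_prop)]
    rfl
  · refine Eventually.of_forall fun t l hl => ?_
    rw [norm_mul]
    refine mul_le_mul_of_nonneg_left ?_ (norm_nonneg _)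
    have h1 : |l| ≤ ‖A‖ := by
      rcases subsingleton_or_nontrivial 𝒜 with h𝒜 | h𝒜
      · simp [spectrum.of_subsingleton] at hl
      · exact spectrum.norm_le_norm_of_mem hl
    rw [Real.norm_eq_abs, abs_of_nonneg (le_max_right _ _)]
    refine max_le ?_ (by positivity)
    linarith [le_abs_self l, neg_abs_le t]

end Kernel

/-! ### The smooth functional calculus of the slots -/

section TprodC

variable {A : Type*} [NormedRing A] [NormedAlgebra ℂ A] {m : ℕ}

variable (A m) in
/-- Elementary tensors of the projective tensor power, as a continuous multilinear map. -/
noncomputable def tprodC : ContinuousMultilinearMap ℂ (fun _ : Fin m => A) (ProjTensor A m) :=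
  (UniformSpace.Completion.toComplL : (⨂[ℂ] _ : Fin m, A) →L[ℂ] ProjTensor A m)
    |>.compContinuousMultilinearMap (PiTensorProduct.tprodL ℂ)

theorem tprodC_apply (v : Fin m → A) : tprodC A m v =
    ((PiTensorProduct.tprod ℂ v : ⨂[ℂ] _ : Fin m, A) : ProjTensor A m) := rfl

theorem tprodC_mul_tprodC (v w : Fin m → A) :
    tprodC A m v * tprodC A m w = tprodC A m (fun j => v j * w j) := by
  rw [tprodC_apply, tprodC_apply, tprodC_apply, ← UniformSpace.Completion.coe_mul,
    PiTensorProduct.tprod_mul_tprod]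
  rfl

theorem tprodC_one : tprodC A m (fun _ => 1) = 1 := rfl

theorem slot_eq_tprodC (j : Fin m) (a : A) :
    slot j a = tprodC A m (Function.update (fun _ => 1) j a) := rfl

end TprodC

/-! ### Integrals of derivatives of cut-off functions against a continuous kernel -/

section CutoffIntegral

variable {m k : ℕ} {B : Type*} [NormedRing B] [NormedAlgebra ℂ B] {V : Set (Fin m → ℝ)}
  {χ : (Fin m → ℝ) → ℂ} {T : (Fin m → ℝ) → B}

theorem iterPartial_cutoff_mul_eq_zero (w : Fin k → Fin m) {f : (Fin m → ℝ) → ℂ} {x : Fin m → ℝ}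
    (hx : x ∉ tsupport χ) : iterPartial w (χ * f) x = 0 := by
  have : χ * f =ᶠ[nhds x] fun _ => 0 := by
    filter_upwards [notMem_tsupport_iff_eventuallyEq.1 hx] with y hy
    simp [hy]
  rw [this.iterPartial_eq, iterPartial, iteratedFDeriv_fun_zero]
  rfl

theorem integrable_iterPartial_cutoff (hV : IsOpen V) (hχ : ContDiff ℝ ∞ χ)
    (hχc : HasCompactSupport χ) (hχV : tsupport χ ⊆ V) (w : Fin k → Fin m) (hT : Continuous T)
    (f : smoothAlg V) :
    Integrable fun x => iterPartial w (χ * (f : (Fin m → ℝ) → ℂ)) x • T x := by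
  refine Continuous.integrable_of_hasCompactSupport
    (((contDiff_mul_cutoff hV f.2 hχ hχV).iterPartial w).continuous.smul hT)
    (HasCompactSupport.intro hχc fun x hx => ?_)
  rw [iterPartial_cutoff_mul_eq_zero w hx, zero_smul]

/-- The linear map `f ↦ ∫ ∂_w (χ f)(x) T(x) dx` on `C^∞(V)`. -/
noncomputable def cutoffIntegral (hV : IsOpen V) (hχ : ContDiff ℝ ∞ χ) (hχc : HasCompactSupport χ)
    (hχV : tsupport χ ⊆ V) (w : Fin k → Fin m) (hT : Continuous T) : smoothAlg V →ₗ[ℂ] B where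
  toFun f := ∫ x, iterPartial w (χ * (f : (Fin m → ℝ) → ℂ)) x • T x
  map_add' f g := by
    rw [← integral_add (integrable_iterPartial_cutoff hV hχ hχc hχV w hT f)
      (integrable_iterPartial_cutoff hV hχ hχc hχV w hT g)]
    congr 1
    ext x
    rw [← add_smul, ← iterPartial_add w (contDiff_mul_cutoff hV f.2 hχ hχV).contDiffAt
      (contDiff_mul_cutoff hV g.2 hχ hχV).contDiffAt, ← mul_add]
    rfl
  map_smul' c f := by
    rw [RingHom.id_apply, ← integral_smul]
    congr 1
    ext x
    rw [← smul_assoc, ← iterPartial_const_smul w c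
      (contDiff_mul_cutoff hV f.2 hχ hχV).contDiffAt, ← mul_smul_comm]
    rfl

theorem smoothBounded_cutoffIntegral (hV : IsOpen V) (hχ : ContDiff ℝ ∞ χ)
    (hχc : HasCompactSupport χ) (hχV : tsupport χ ⊆ V) (w : Fin k → Fin m) (hT : Continuous T) :
    SmoothBounded (cutoffIntegral hV hχ hχc hχV w hT) := by
  obtain ⟨D, hD0, hD⟩ := exists_norm_iteratedFDeriv_mul_le hV hχ.contDiffOn hχc.isCompact hχV k
  obtain ⟨τ, hτ⟩ := hχc.isCompact.exists_bound_of_continuousOn hT.continuousOn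
  refine ⟨tsupport χ, hχc, hχV, k, D * |τ| * volume.real (tsupport χ), fun f M hM hf => ?_⟩
  change ‖∫ x, iterPartial w (χ * (f : (Fin m → ℝ) → ℂ)) x • T x‖ ≤ _
  rw [← setIntegral_eq_integral_of_forall_compl_eq_zero (s := tsupport χ) fun x hx => by
    rw [iterPartial_cutoff_mul_eq_zero w hx, zero_smul]]
  refine (norm_setIntegral_le_of_norm_le_const (C := D * M * |τ|)
    hχc.isCompact.measure_lt_top fun x hx => ?_).trans (le_of_eq (by ring))
  rw [norm_smul]
  refine mul_le_mul ?_ ((hτ x hx).trans (le_abs_self τ)) (norm_nonneg _) (by positivity)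
  exact (norm_iterPartial_le w _ x).trans
    (hD f f.2 M x hx (fun l hl => hf l hl x hx) k le_rfl)

end CutoffIntegral

/-! ### Existence of the calculus of the slots of a selfadjoint element -/

section SlotCalculus

variable {𝒜 : Type*} [CStarAlgebra 𝒜] {m : ℕ}

theorem iteratedDeriv_two_ofReal {φ : ℝ → ℝ} (hφ : ContDiff ℝ ∞ φ) (t : ℝ) :
    iteratedDeriv 2 (fun t => (φ t : ℂ)) t = (iteratedDeriv 2 φ t : ℝ) := by
  have hφ' : ContDiff ℝ ∞ (deriv φ) := (contDiff_infty_iff_deriv.1 hφ).2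
  have h1 : deriv (fun t => (φ t : ℂ)) = fun t => ((deriv φ t : ℝ) : ℂ) := by
    ext s
    exact ((hφ.differentiable (by simp) s).hasDerivAt.ofReal_comp).deriv
  rw [iteratedDeriv_succ, iteratedDeriv_one, iteratedDeriv_succ, iteratedDeriv_one, h1]
  exact ((hφ'.differentiable (by simp) t).hasDerivAt.ofReal_comp).deriv

/-- The word in `Fin m` that contains every letter twice. -/
def doubleWord (m : ℕ) : Fin (m * 2) → Fin m := fun l => (finProdFinEquiv.symm l).1

theorem sum_doubleWord (j : Fin m) : ∑ l, (if doubleWord m l = j then 1 else 0) = 2 := by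
  rw [← finProdFinEquiv.sum_comp]
  simp only [doubleWord, Equiv.symm_apply_apply, Fintype.sum_prod_type]
  simp [apply_ite Finset.card]

theorem isOpen_setPow {U : Set ℝ} (hU : IsOpen U) : IsOpen (setPow m U) :=
  isOpen_set_pi finite_univ fun _ _ => hU

theorem isCompact_setPow {K : Set ℝ} (hK : IsCompact K) : IsCompact (setPow m K) :=
  isCompact_univ_pi fun _ => hK

/-- On a product function the double word takes the second derivative in each variable.
Multilinearity moves these scalars into the slots, and Fubini leaves the one-dimensional kernel
formula in each slot. -/
theorem integral_iterPartial_prod_smul_tprodC {A : 𝒜} (hA : IsSelfAdjoint A)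
    {φ : Fin m → ℝ → ℝ} (hφ : ∀ j, ContDiff ℝ ∞ (φ j)) (hc : ∀ j, HasCompactSupport (φ j)) :
    ∫ x : Fin m → ℝ, iterPartial (doubleWord m) (fun x => ∏ j, (φ j (x j) : ℂ)) x •
      tprodC 𝒜 m (fun j => posPartSub A (x j)) = tprodC 𝒜 m fun j => cfc (φ j) A := by
  have h1 : ∀ x : Fin m → ℝ, iterPartial (doubleWord m) (fun x => ∏ j, (φ j (x j) : ℂ)) x •
      tprodC 𝒜 m (fun j => posPartSub A (x j))
      = tprodC 𝒜 m fun j => iteratedDeriv 2 (φ j) (x j) • posPartSub A (x j) := by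
    intro x
    rw [iterPartial_prod (φ := fun j t => (φ j t : ℂ)) (doubleWord m)
      fun j => Complex.ofRealCLM.contDiff.comp (hφ j)]
    simp only [sum_doubleWord, iteratedDeriv_two_ofReal (hφ _)]
    rw [← ContinuousMultilinearMap.map_smul_univ]
    simp only [Complex.coe_smul]
  simp only [h1]
  rw [ContinuousMultilinearMap.integral_apply_pi (tprodC 𝒜 m)
    (v := fun j t => iteratedDeriv 2 (φ j) t • posPartSub A t)]
  · simp only [integral_iteratedDeriv_two_smul_posPartSub hA (hφ _) (hc _)]
  · exact fun j => ((hφ j).continuous_iteratedDeriv 2 (by norm_cast)).smul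
      (continuous_posPartSub A)
  · intro j
    have : HasCompactSupport (iteratedDeriv 2 (φ j)) := by
      rw [iteratedDeriv_succ, iteratedDeriv_one]
      exact (hc j).deriv.deriv
    exact this.smul_right

/-- The calculus is the integral of `∂₀² ⋯ (χ f)` against the tensors of `(A - x_j)₊`. The
projective norm enters only through continuity of the elementary tensor map. -/
theorem exists_isSmoothCalculus_slot {A : 𝒜} (hA : IsSelfAdjoint A) {U : Set ℝ} (hU : IsOpen U)
    (hAU : spectrum ℝ A ⊆ U) : ∃ Φ : smoothAlg (setPow m U) →ₐ[ℂ] ProjTensor 𝒜 m,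
      IsSmoothCalculus (setPow m U) (fun j => slot j A) Φ := by
  obtain ⟨η, hη, hηc, hηU, hη1⟩ := exists_contDiff_cutoff (spectrum.isCompact A) hU hAU
  let χ : (Fin m → ℝ) → ℂ := fun x => ∏ j, (η (x j) : ℂ)
  have hχ : ContDiff ℝ ∞ χ := contDiff_prod fun j _ =>
    Complex.ofRealCLM.contDiff.comp (hη.comp (contDiff_apply ℝ ℝ j))
  have hχs : tsupport χ ⊆ setPow m (tsupport η) := by
    refine closure_minimal (fun x hx j _ => subset_tsupport _ fun h0 => hx ?_)
      (isClosed_set_pi fun _ _ => isClosed_tsupport _)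
    exact Finset.prod_eq_zero (Finset.mem_univ j) (by simp [h0])
  have hχc : HasCompactSupport χ :=
    (isCompact_setPow hηc).of_isClosed_subset (isClosed_tsupport _) hχs
  have hV : IsOpen (setPow m U) := isOpen_setPow hU
  have hχV : tsupport χ ⊆ setPow m U := hχs.trans (pi_mono fun _ _ => hηU)
  have hT : Continuous fun x : Fin m → ℝ => tprodC 𝒜 m fun j => posPartSub A (x j) :=
    (tprodC 𝒜 m).cont.comp (continuous_pi fun j =>
      (continuous_posPartSub A).comp (continuous_apply j))
  let L := cutoffIntegral hV hχ hχc hχV (doubleWord m) hT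
  have hmon : ∀ s : Fin m →₀ ℕ, L (smoothPoly _ (MvPolynomial.monomial s 1))
      = tprodC 𝒜 m fun j => A ^ s j := by
    intro s
    have h1 : χ * (smoothPoly (setPow m U) (MvPolynomial.monomial s 1) : (Fin m → ℝ) → ℂ)
        = fun x => ∏ j, ((η (x j) * x j ^ s j : ℝ) : ℂ) := by
      ext x
      simp only [Pi.mul_apply, coe_smoothPoly]
      rw [MvPolynomial.eval_monomial, one_mul,
        Finsupp.prod_fintype _ _ (by simp), ← Finset.prod_mul_distrib]
      push_cast
      rfl
    change ∫ x, iterPartial (doubleWord m) (χ * _) x • _ = _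
    rw [h1, integral_iterPartial_prod_smul_tprodC hA (φ := fun j t => η t * t ^ s j)
      (fun j => hη.mul (contDiff_id.pow _)) fun j => hηc.mul_right]
    congr 1
    ext j
    rw [← cfc_pow_id A (s j) hA (R := ℝ)]
    -- The cutoff `η` is 1 on the spectrum, so it disappears from the functional calculus.
    refine cfc_congr fun t ht => ?_
    simp [(hη1 t ht).eq_of_nhds]
  have hmul : ∀ p q, L (smoothPoly _ (p * q)) = L (smoothPoly _ p) * L (smoothPoly _ q) := by
    have hsmul : ∀ (s : Fin m →₀ ℕ) (c : ℂ), L (smoothPoly _ (MvPolynomial.monomial s c))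
        = c • tprodC 𝒜 m fun j => A ^ s j := by
      intro s c
      rw [← hmon, ← map_smul, ← map_smul, MvPolynomial.smul_monomial, smul_eq_mul, mul_one]
    intro p q
    induction p using MvPolynomial.induction_on' with
    | add p p' hp hp' => rw [add_mul, map_add, map_add, hp, hp', map_add, map_add, add_mul]
    | monomial s c =>
      induction q using MvPolynomial.induction_on' with
      | add q q' hq hq' => rw [mul_add, map_add, map_add, hq, hq', map_add, map_add, mul_add]
      | monomial s' c' =>
        rw [MvPolynomial.monomial_mul, hsmul, hsmul, hsmul, smul_mul_smul_comm, tprodC_mul_tprodC]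
        simp only [← pow_add]
        rfl
  have hLb := smoothBounded_cutoffIntegral hV hχ hχc hχV (doubleWord m) hT
  refine ⟨AlgHom.ofLinearMap L ?_ (hLb.map_mul hV hmul), fun j => ?_, hLb⟩
  · rw [← map_one (smoothPoly (setPow m U)), MvPolynomial.one_def, hmon]
    simp [tprodC_one]
  · have h1 : smoothCoord (setPow m U) j = smoothPoly _ (MvPolynomial.monomial (.single j 1) 1) := by
      change _ = smoothPoly _ (MvPolynomial.X j)
      simp [smoothPoly]
    rw [AlgHom.ofLinearMap_apply, h1, hmon, slot_eq_tprodC]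
    congr 1
    ext i
    by_cases hij : i = j
    · subst hij; simp
    · rw [Finsupp.single_apply, if_neg (Ne.symm hij), pow_zero, Function.update_of_ne hij]

end SlotCalculus

/-! ### Integration of smooth families -/

section AbstractIntegral

/-- A linear map `Φ` whose norm is dominated by that of a linear map `J` into a Banach space
commutes with integrals that `J` commutes with. -/
theorem LinearMap.integral_comm_of_norm_le {W E B α : Type*} [AddCommGroup W] [Module ℂ W]
    [NormedAddCommGroup E] [NormedSpace ℂ E] [CompleteSpace E] [NormedAddCommGroup B]
    [NormedSpace ℂ B] [CompleteSpace B] [MeasurableSpace α] {μ : Measure α} (Φ : W →ₗ[ℂ] B)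
    (J : W →ₗ[ℂ] E) {C : ℝ} (hC : ∀ w, ‖Φ w‖ ≤ C * ‖J w‖) {g : α → W} {w₀ : W}
    (hg : Integrable (fun u => J (g u)) μ) (hw₀ : ∫ u, J (g u) ∂μ = J w₀) :
    Integrable (fun u => Φ (g u)) μ ∧ ∫ u, Φ (g u) ∂μ = Φ w₀ := by
  let S : Submodule ℂ E := (LinearMap.range J).topologicalClosure
  have hJS : ∀ w, J w ∈ S := fun w =>
    Submodule.le_topologicalClosure _ (LinearMap.mem_range_self J w)
  -- The range of `J` need not be dense in `E`. Restricting the target to its closure makes it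
  -- dense, so that `Φ` factors through a continuous linear map on a Banach space.
  let J' : W →ₗ[ℂ] S := J.codRestrict S hJS
  have hdense : DenseRange J' := by
    intro s
    rw [Topology.IsInducing.subtypeVal.closure_eq_preimage_closure_image]
    refine closure_mono ?_ (show (s : E) ∈ closure (LinearMap.range J : Set E) from s.2)
    rintro _ ⟨w, rfl⟩
    exact ⟨J' w, ⟨w, rfl⟩, rfl⟩
  have hext : ∀ w, Φ.extendOfNorm J' (J' w) = Φ w :=
    LinearMap.extendOfNorm_eq hdense ⟨C, hC⟩
  have : CompleteSpace S := (Submodule.isClosed_topologicalClosure _).completeSpace_coe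
  have hg' : Integrable (fun u => J' (g u)) μ := by
    refine ⟨?_, hg.2⟩
    exact (Topology.IsEmbedding.subtypeVal (p := (· ∈ S))).aestronglyMeasurable_comp_iff.1 hg.1
  have hint : ∫ u, J' (g u) ∂μ = J' w₀ := by
    refine Subtype.ext ?_
    have := S.subtypeL.integral_comp_comm hg'
    exact this.symm.trans hw₀
  have h1 := (Φ.extendOfNorm J').integrable_comp hg'
  have h2 := (Φ.extendOfNorm J').integral_comp_comm hg'
  simp only [hext] at h1 h2
  rw [hint, hext] at h2
  exact ⟨h1, h2⟩

end AbstractIntegral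

/-! ### Differentiation under the integral and exchange with the calculus -/

section Families

open Filter Topology

variable {m : ℕ} {V : Set (Fin m → ℝ)} {f : ℝ → (Fin m → ℝ) → ℂ}

/-- A smooth family `f u`, `u > 0`, of functions on `V` whose partial derivatives are integrable in
`u`, locally uniformly on `V`. -/
structure IsIntegrableFamily (V : Set (Fin m → ℝ)) (f : ℝ → (Fin m → ℝ) → ℂ) : Prop where
  contDiffOn : ContDiffOn ℝ ∞ (fun p : ℝ × (Fin m → ℝ) => f p.1 p.2) (Ioi 0 ×ˢ V)
  lintegral_lt_top : ∀ K, IsCompact K → K ⊆ V → ∀ (k : ℕ) (i : Fin k → Fin m),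
    ∫⁻ u in Ioi (0 : ℝ), ⨆ x ∈ K, ‖iterPartial i (f u) x‖ₑ < ⊤

theorem IsIntegrableFamily.contDiffOn_apply (hf : IsIntegrableFamily V f) {u : ℝ} (hu : 0 < u) :
    ContDiffOn ℝ ∞ (f u) V :=
  hf.contDiffOn.comp (f := fun x => (u, x)) (contDiffOn_const.prodMk contDiffOn_id)
    fun _ hx => ⟨hu, hx⟩

theorem IsIntegrableFamily.contDiffAt (hV : IsOpen V) (hf : IsIntegrableFamily V f) {u : ℝ}
    (hu : 0 < u) {x : Fin m → ℝ} (hx : x ∈ V) : ContDiffAt ℝ ∞ (f u) x :=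
  (hf.contDiffOn_apply hu).contDiffAt (hV.mem_nhds hx)

/-- This turns the integrated suprema into Bochner integrability in the Banach space `C(K, ℂ)`.
Measurability comes from joint continuity, by currying. -/
theorem IsIntegrableFamily.exists_continuousMap (hV : IsOpen V) (hf : IsIntegrableFamily V f)
    {K : Set (Fin m → ℝ)} (hK : IsCompact K) [CompactSpace K] (hKV : K ⊆ V) {k : ℕ}
    (i : Fin k → Fin m) :
    ∃ G : ℝ → C(K, ℂ), IntegrableOn G (Ioi 0) ∧
      ∀ u, 0 < u → ∀ x : K, G u x = iterPartial i (f u) x := by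
  have hcont : ContinuousOn (fun p : ℝ × (Fin m → ℝ) => iterPartial i (f p.1) p.2)
      (Ioi 0 ×ˢ V) :=
    (ContDiffAt.iterPartial_uncurry i (isOpen_Ioi.prod hV) hf.contDiffOn).continuousOn
  let c : C(Ioi (0 : ℝ), C(K, ℂ)) := ContinuousMap.curry
    ⟨fun p : Ioi (0 : ℝ) × K => iterPartial i (f p.1) p.2, hcont.comp_continuous
      (f := fun p : Ioi (0 : ℝ) × K => ((p.1 : ℝ), (p.2 : Fin m → ℝ))) (by fun_prop)
      fun p => ⟨p.1.2, hKV p.2.2⟩⟩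
  let G : ℝ → C(K, ℂ) := fun u => if h : 0 < u then c ⟨u, h⟩ else 0
  have hG : ∀ u, 0 < u → ∀ x : K, G u x = iterPartial i (f u) x := by
    intro u hu x
    simp [G, hu, c]
  refine ⟨G, ⟨?_, ?_⟩, hG⟩
  · refine ContinuousOn.aestronglyMeasurable ?_ measurableSet_Ioi
    rw [continuousOn_iff_continuous_domRestrict]
    convert c.continuous using 1
    ext1 u
    exact dif_pos u.2
  · refine lt_of_le_of_lt (setLIntegral_mono' measurableSet_Ioi fun u hu => ?_)
      (hf.lintegral_lt_top K hK hKV k i)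
    set s := ⨆ x ∈ K, ‖iterPartial i (f u) x‖ₑ with hs
    -- The value `⊤` has real part `0` under `toReal`, so it is treated apart; there the estimate is
    -- trivial.
    by_cases htop : s = ⊤
    · rw [htop]; exact le_top
    · rw [← ofReal_norm, ← ENNReal.ofReal_toReal htop]
      refine ENNReal.ofReal_le_ofReal ((ContinuousMap.norm_le _ ENNReal.toReal_nonneg).2 fun x => ?_)
      rw [hG u hu, ← toReal_enorm]
      exact ENNReal.toReal_mono htop (le_iSup₂ (f := fun x (_ : x ∈ K) =>
        ‖iterPartial i (f u) x‖ₑ) (x : Fin m → ℝ) x.2)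

theorem IsIntegrableFamily.integrableOn_iterPartial (hV : IsOpen V) (hf : IsIntegrableFamily V f)
    {x : Fin m → ℝ} (hx : x ∈ V) {k : ℕ} (i : Fin k → Fin m) :
    IntegrableOn (fun u => iterPartial i (f u) x) (Ioi 0) := by
  have : CompactSpace ({x} : Set (Fin m → ℝ)) := isCompact_iff_compactSpace.1 isCompact_singleton
  obtain ⟨G, hG, hGe⟩ := hf.exists_continuousMap hV (K := {x}) isCompact_singleton (by simpa) i
  refine IntegrableOn.congr_fun ((ContinuousMap.evalCLM ℂ (⟨x, rfl⟩ :
    ({x} : Set (Fin m → ℝ)))).integrable_comp hG) (fun u hu => ?_) measurableSet_Ioi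
  exact hGe u hu ⟨x, rfl⟩

theorem hasFDerivAt_iterPartial {k : ℕ} (i : Fin k → Fin m) {g : (Fin m → ℝ) → ℂ}
    {x : Fin m → ℝ} (hg : ContDiffAt ℝ ∞ g x) :
    HasFDerivAt (iterPartial i g) (∑ j, (ContinuousLinearMap.proj (R := ℝ)
      (φ := fun _ : Fin m => ℝ) j).smulRight (iterPartial (Fin.cons j i) g x)) x := by
  have h := ((hg.iterPartial i).differentiableAt (by simp)).hasFDerivAt
  refine h.congr_fderiv ?_
  have h1 : ∀ j, iterPartial (Fin.cons j i : Fin (k + 1) → Fin m) g x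
      = fderiv ℝ (iterPartial i g) x (Pi.single j 1) := fun j => by
    rw [iterPartial_succ _ hg, Fin.tail_cons, Fin.cons_zero]
  refine ContinuousLinearMap.ext fun v => ?_
  conv_lhs => rw [pi_eq_sum_univ' v, map_sum]
  simp only [_root_.sum_apply, ContinuousLinearMap.smulRight_apply,
    ContinuousLinearMap.proj_apply, h1, map_smul]

theorem hasFDerivAt_setIntegral_of_partial {g : ℝ → (Fin m → ℝ) → ℂ}
    {g' : Fin m → ℝ → (Fin m → ℝ) → ℂ} {x : Fin m → ℝ} {K : Set (Fin m → ℝ)} (hK : K ∈ 𝓝 x)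
    {β : Fin m → ℝ → ℝ} (hg : ∀ y ∈ K, IntegrableOn (fun u => g u y) (Ioi 0))
    (hg' : ∀ j, IntegrableOn (fun u => g' j u x) (Ioi 0)) (hβ : ∀ j, IntegrableOn (β j) (Ioi 0))
    (hle : ∀ j u, 0 < u → ∀ y ∈ K, ‖g' j u y‖ ≤ β j u)
    (hd : ∀ u, 0 < u → ∀ y ∈ K, HasFDerivAt (g u) (∑ j, (ContinuousLinearMap.proj (R := ℝ)
      (φ := fun _ : Fin m => ℝ) j).smulRight (g' j u y)) y) :
    HasFDerivAt (fun y => ∫ u in Ioi (0 : ℝ), g u y) (∑ j, (ContinuousLinearMap.proj (R := ℝ)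
      (φ := fun _ : Fin m => ℝ) j).smulRight (∫ u in Ioi (0 : ℝ), g' j u x)) x := by
  -- `R j` is `smulRight` viewed as a continuous linear map of the value, and therefore commutes
  -- with the integral.
  obtain ⟨R, hR⟩ : ∃ R : Fin m → ℂ →L[ℝ] ((Fin m → ℝ) →L[ℝ] ℂ), ∀ j z,
      (ContinuousLinearMap.proj (R := ℝ) (φ := fun _ : Fin m => ℝ) j).smulRight z = R j z :=
    ⟨fun j => ContinuousLinearMap.smulRightL ℝ (Fin m → ℝ) ℂ
      (ContinuousLinearMap.proj (R := ℝ) (φ := fun _ : Fin m => ℝ) j), fun _ _ => rfl⟩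
  simp only [hR] at hd ⊢
  have hint : ∀ j, Integrable (fun u => R j (g' j u x)) (volume.restrict (Ioi 0)) := fun j =>
    (R j).integrable_comp (hg' j)
  have h1 : ∫ u in Ioi (0 : ℝ), ∑ j, R j (g' j u x)
      = ∑ j, R j (∫ u in Ioi (0 : ℝ), g' j u x) := by
    rw [integral_finsetSum _ fun j _ => hint j]
    exact Finset.sum_congr rfl fun j _ => (R j).integral_comp_comm (hg' j)
  have hbound : ∀ᵐ u ∂volume.restrict (Ioi (0 : ℝ)), ∀ y ∈ K,
      ‖∑ j, R j (g' j u y)‖ ≤ ∑ j, ‖R j‖ * β j u := by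
    filter_upwards [ae_restrict_mem measurableSet_Ioi] with u hu y hy
    exact (norm_sum_le _ _).trans (Finset.sum_le_sum fun j _ => ((R j).le_opNorm _).trans
      (mul_le_mul_of_nonneg_left (hle j u hu y hy) (norm_nonneg _)))
  have hbint : Integrable (fun u => ∑ j, ‖R j‖ * β j u) (volume.restrict (Ioi (0 : ℝ))) :=
    integrable_finsetSum _ fun j _ => (hβ j).const_mul _
  have hmeas : ∀ᶠ y in 𝓝 x,
      AEStronglyMeasurable (fun u => g u y) (volume.restrict (Ioi (0 : ℝ))) := by
    filter_upwards [hK] with y hy using (hg y hy).1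
  have hd' : ∀ᵐ u ∂volume.restrict (Ioi (0 : ℝ)), ∀ y ∈ K,
      HasFDerivAt (g u) (∑ j, R j (g' j u y)) y := by
    filter_upwards [ae_restrict_mem measurableSet_Ioi] with u hu y hy using hd u hu y hy
  have hmeas' : AEStronglyMeasurable (fun u => ∑ j, R j (g' j u x))
      (volume.restrict (Ioi (0 : ℝ))) :=
    Finset.aestronglyMeasurable_fun_sum _ fun j _ => (hint j).1
  rw [← h1]
  exact hasFDerivAt_integral_of_dominated_of_fderiv_le (F := fun y u => g u y)
    (F' := fun y u => ∑ j, R j (g' j u y)) hK hmeas (hg x (mem_of_mem_nhds hK))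
    hmeas' hbound hbint hd'

/-- Dominated differentiation on a compact neighbourhood `K` of `x`; the dominating functions are
the norms in `C(K, ℂ)` of the derivatives by one further letter. -/
theorem IsIntegrableFamily.hasFDerivAt_integral (hV : IsOpen V) (hf : IsIntegrableFamily V f)
    {x : Fin m → ℝ} (hx : x ∈ V) {k : ℕ} (i : Fin k → Fin m) :
    HasFDerivAt (fun y => ∫ u in Ioi (0 : ℝ), iterPartial i (f u) y)
      (∑ j, (ContinuousLinearMap.proj (R := ℝ) (φ := fun _ : Fin m => ℝ) j).smulRight
        (∫ u in Ioi (0 : ℝ), iterPartial (Fin.cons j i : Fin (k + 1) → Fin m) (f u) x)) x := by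
  obtain ⟨K, hK, hxK, hKV⟩ := exists_compact_subset hV hx
  have : CompactSpace K := isCompact_iff_compactSpace.1 hK
  have hG := fun j : Fin m => hf.exists_continuousMap hV hK hKV (Fin.cons j i : Fin (k + 1) → Fin m)
  choose G hG hGe using hG
  refine hasFDerivAt_setIntegral_of_partial (mem_interior_iff_mem_nhds.1 hxK)
    (g' := fun j u => iterPartial (Fin.cons j i : Fin (k + 1) → Fin m) (f u))
    (β := fun j u => ‖G j u‖)
    (fun y hy => hf.integrableOn_iterPartial hV (hKV hy) i)
    (fun j => hf.integrableOn_iterPartial hV hx _) (fun j => (hG j).norm)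
    (fun j u hu y hy => ?_)
    (fun u hu y hy => hasFDerivAt_iterPartial i (hf.contDiffAt hV hu (hKV hy)))
  rw [← hGe j u hu ⟨y, hy⟩]
  exact (G j u).norm_coe_le_norm _

/-- The derivative of such an integral is built from integrals of the same kind with longer words,
so the induction on `n` runs over all words. -/
theorem IsIntegrableFamily.contDiffOn_integral_iterPartial (hV : IsOpen V)
    (hf : IsIntegrableFamily V f) (n : ℕ) {k : ℕ} (i : Fin k → Fin m) :
    ContDiffOn ℝ n (fun y => ∫ u in Ioi (0 : ℝ), iterPartial i (f u) y) V := by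
  induction n generalizing k with
  | zero =>
    exact contDiffOn_zero.2 fun x hx =>
      (hf.hasFDerivAt_integral hV hx i).continuousAt.continuousWithinAt
  | succ n ih =>
    have := (contDiffOn_succ_iff_fderiv_of_isOpen (𝕜 := ℝ) (n := n)
      (f := fun y => ∫ u in Ioi (0 : ℝ), iterPartial i (f u) y) hV).2
      ⟨fun x hx => (hf.hasFDerivAt_integral hV hx i).differentiableAt.differentiableWithinAt,
        by simp, ?_⟩
    · exact_mod_cast this
    · refine ContDiffOn.congr ?_ fun x hx => (hf.hasFDerivAt_integral hV hx i).fderiv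
      exact ContDiffOn.sum fun j _ => (ContinuousLinearMap.smulRightL ℝ (Fin m → ℝ) ℂ
        (ContinuousLinearMap.proj (R := ℝ) (φ := fun _ : Fin m => ℝ) j)).contDiff.comp_contDiffOn
        (ih (Fin.cons j i : Fin (k + 1) → Fin m))

theorem IsIntegrableFamily.contDiffOn_integral (hV : IsOpen V) (hf : IsIntegrableFamily V f) :
    ContDiffOn ℝ ∞ (fun y => ∫ u in Ioi (0 : ℝ), f u y) V := by
  refine contDiffOn_infty.2 fun n => ?_
  simpa only [iterPartial_zero] using
    hf.contDiffOn_integral_iterPartial hV n (Fin.elim0 : Fin 0 → Fin m)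

theorem IsIntegrableFamily.iterPartial_integral (hV : IsOpen V) (hf : IsIntegrableFamily V f)
    {x : Fin m → ℝ} (hx : x ∈ V) {k : ℕ} (i : Fin k → Fin m) :
    iterPartial i (fun y => ∫ u in Ioi (0 : ℝ), f u y) x
      = ∫ u in Ioi (0 : ℝ), iterPartial i (f u) x := by
  induction k generalizing x with
  | zero => simp only [iterPartial_zero]
  | succ k ih =>
    rw [iterPartial_succ i ((hf.contDiffOn_integral hV).contDiffAt (hV.mem_nhds hx))]
    have hev : iterPartial (Fin.tail i) (fun y => ∫ u in Ioi (0 : ℝ), f u y) =ᶠ[𝓝 x]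
        fun y => ∫ u in Ioi (0 : ℝ), iterPartial (Fin.tail i) (f u) y := by
      filter_upwards [hV.mem_nhds hx] with y hy using ih hy _
    rw [hev.fderiv_eq, (hf.hasFDerivAt_integral hV hx _).fderiv, _root_.sum_apply,
      Finset.sum_eq_single (i 0) (fun l _ hl => by simp [Pi.single_eq_of_ne hl]) (by simp)]
    have : (Fin.cons (i 0) (Fin.tail i) : Fin (k + 1) → Fin m) = i := Fin.cons_self_tail i
    simp [this]

/-- The continuity bound of `Φ` involves only the jet `J` of order `N` on `K`, which lives in a
Banach space. Integrating jets there avoids integration in the Fréchet space `C^∞(V)`. -/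
theorem IsIntegrableFamily.integrableOn_smoothCalc (hV : IsOpen V) (hf : IsIntegrableFamily V f)
    {B : Type*} [NormedRing B] [NormedAlgebra ℂ B] [CompleteSpace B] {b : Fin m → B}
    {Φ : smoothAlg V →ₐ[ℂ] B} (hΦ : IsSmoothCalculus V b Φ) :
    IntegrableOn (fun u => smoothCalc V (f u) b) (Ioi 0) ∧
      ∫ u in Ioi (0 : ℝ), smoothCalc V (f u) b
        = smoothCalc V (fun y => ∫ u in Ioi (0 : ℝ), f u y) b := by
  obtain ⟨K, hK, hKV, N, C, hC⟩ := hΦ.continuous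
  have : CompactSpace K := isCompact_iff_compactSpace.1 hK
  let ι := Σ k : Fin (N + 1), Fin k → Fin m
  have hcd : ∀ (g : smoothAlg V) x, x ∈ V → ContDiffAt ℝ ∞ (g : (Fin m → ℝ) → ℂ) x :=
    fun g x hx => ContDiffOn.contDiffAt g.2 (hV.mem_nhds hx)
  let J : smoothAlg V →ₗ[ℂ] (ι → C(K, ℂ)) :=
    { toFun := fun g a => ⟨fun x => iterPartial a.2 (g : (Fin m → ℝ) → ℂ) x,
        continuous_iff_continuousAt.2 fun x => ((hcd g x (hKV x.2)).iterPartial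
          a.2).continuousAt.comp continuous_subtype_val.continuousAt⟩
      map_add' := fun g h => by
        ext a x
        exact iterPartial_add a.2 (hcd g x (hKV x.2)) (hcd h x (hKV x.2))
      map_smul' := fun c g => by
        ext a x
        exact iterPartial_const_smul a.2 c (hcd g x (hKV x.2)) }
  have hJ : ∀ g, ‖Φ.toLinearMap g‖ ≤ C * Fintype.card ι * ‖J g‖ := by
    intro g
    rw [mul_assoc]
    refine hC g _ (by positivity) fun k hk x hx => (norm_iteratedFDeriv_le_sum k _ x).trans ?_
    have hterm : ∀ i : Fin k → Fin m, ‖iterPartial i (g : (Fin m → ℝ) → ℂ) x‖ ≤ ‖J g‖ := fun i =>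
      ((J g ⟨⟨k, by omega⟩, i⟩).norm_coe_le_norm ⟨x, hx⟩).trans (norm_le_pi_norm (J g) _)
    refine (Finset.sum_le_sum fun i _ => hterm i).trans ?_
    rw [Finset.sum_const, Finset.card_univ, nsmul_eq_mul]
    refine mul_le_mul_of_nonneg_right (Nat.cast_le.2 (Fintype.card_le_of_injective
      (fun i => (⟨⟨k, by omega⟩, i⟩ : ι)) fun i j hij => ?_)) (norm_nonneg _)
    exact eq_of_heq (Sigma.mk.inj hij).2
  let g : ℝ → smoothAlg V := fun u => if h : 0 < u then ⟨f u, hf.contDiffOn_apply h⟩ else 0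
  have hgu : ∀ u, 0 < u → (g u : (Fin m → ℝ) → ℂ) = f u := fun u hu => by
    simp only [g, dif_pos hu]
  choose G hG hGe using fun a : ι => hf.exists_continuousMap hV hK hKV a.2
  have hJG : ∀ u, 0 < u → ∀ a, G a u = J (g u) a := by
    intro u hu a
    ext x
    rw [hGe a u hu x, ← hgu u hu]
    rfl
  have hJint : IntegrableOn (fun u => J (g u)) (Ioi 0) :=
    Integrable.of_eval fun a => IntegrableOn.congr_fun (hG a) (fun u hu => hJG u hu a)
      measurableSet_Ioi
  have hF := hf.contDiffOn_integral hV
  have hw₀ : ∫ u in Ioi (0 : ℝ), J (g u) = J ⟨_, hF⟩ := by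
    ext a x
    have h1 := ((ContinuousMap.evalCLM ℂ x).comp
      (ContinuousLinearMap.proj (R := ℂ) (φ := fun _ : ι => C(K, ℂ)) a)).integral_comp_comm hJint
    refine h1.symm.trans ?_
    refine Eq.trans ?_ (hf.iterPartial_integral hV (hKV x.2) a.2).symm
    refine setIntegral_congr_fun measurableSet_Ioi fun u hu => ?_
    rw [← hGe a u hu x, hJG u hu a]
    rfl
  obtain ⟨h1, h2⟩ := LinearMap.integral_comm_of_norm_le Φ.toLinearMap J hJ hJint hw₀
  have hcalc : ∀ u, 0 < u → Φ.toLinearMap (g u) = smoothCalc V (f u) b := by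
    intro u hu
    rw [hΦ.smoothCalc_eq hV (hf.contDiffOn_apply hu)]
    simp only [g, dif_pos hu]
    rfl
  refine ⟨IntegrableOn.congr_fun h1 (fun u hu => hcalc u hu) measurableSet_Ioi, ?_⟩
  rw [hΦ.smoothCalc_eq hV hF]
  refine Eq.trans ?_ h2
  exact setIntegral_congr_fun measurableSet_Ioi fun u hu => (hcalc u hu).symm

end Families

/-! ### Slots and modular operators -/

section Slots

variable {A : Type*} [NormedRing A] [NormedAlgebra ℂ A] {m : ℕ}

variable (A) in
/-- The embedding of `A` into a slot of the projective tensor power, as an algebra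
homomorphism. -/
noncomputable def slotHom (j : Fin m) : A →ₐ[ℂ] ProjTensor A m :=
  AlgHom.ofLinearMap ((tprodC A m).toMultilinearMap.toLinearMap (fun _ => 1) j)
    (by
      change tprodC A m (Function.update (fun _ => 1) j 1) = 1
      rw [Function.update_eq_self_iff.2 rfl]; exact tprodC_one)
    (by
      intro a b
      change tprodC A m _ = tprodC A m _ * tprodC A m _
      rw [tprodC_mul_tprodC]
      congr 1
      ext i
      by_cases h : i = j
      · subst h; simp
      · simp [Function.update_of_ne h])

theorem slotHom_apply (j : Fin m) (a : A) : slotHom A j a = slot j a := rfl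

theorem continuous_slotHom (j : Fin m) : Continuous (slotHom A j) :=
  (tprodC A m).cont.comp (continuous_const.update j continuous_id)

theorem commute_slot_slot {i j : Fin m} (h : i ≠ j) (a b : A) :
    Commute (slot i a : ProjTensor A m) (slot j b) := by
  change _ * _ = _ * _
  rw [slot_eq_tprodC, slot_eq_tprodC, tprodC_mul_tprodC, tprodC_mul_tprodC]
  congr 1
  ext l
  by_cases hi : l = i
  · subst hi; simp [Function.update_of_ne h]
  · simp [Function.update_of_ne hi]

variable [CompleteSpace A]

theorem slot_exp (j : Fin m) (a : A) :
    (slot j (NormedSpace.exp a) : ProjTensor A m) = NormedSpace.exp (slot j a) :=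
  let : NormedAlgebra ℚ A := NormedAlgebra.restrictScalars ℚ ℂ A
  let : NormedAlgebra ℚ (ProjTensor A m) := NormedAlgebra.restrictScalars ℚ ℂ (ProjTensor A m)
  NormedSpace.map_exp (slotHom A j) (continuous_slotHom j) a

theorem exp_neg_mul_exp (a : A) : NormedSpace.exp (-a) * NormedSpace.exp a = 1 := by
  let : NormedAlgebra ℚ A := NormedAlgebra.restrictScalars ℚ ℂ A
  rw [← NormedSpace.exp_add_of_commute (Commute.neg_left (Commute.refl a)), neg_add_cancel,
    NormedSpace.exp_zero]

theorem exp_mul_exp_neg (a : A) : NormedSpace.exp a * NormedSpace.exp (-a) = 1 := by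
  simpa using exp_neg_mul_exp (-a)

/-- The two summands of `∇^{(j)}` lie in different slots and commute, so its exponential splits into
`e^{-a}` in slot `j - 1` and `e^a` in slot `j`; the partial products then telescope. -/
theorem modularProd_eq {n : ℕ} (a : A) (j : Fin (n + 1)) :
    modularProd a j = slot 0 (NormedSpace.exp (-a)) * slot j (NormedSpace.exp a) := by
  induction j using Fin.induction with
  | zero =>
    rw [← slotHom_apply, ← slotHom_apply, ← map_mul, exp_neg_mul_exp, map_one]
    exact Fin.partialProd_zero _
  | succ j ih =>
    have hc : Commute (-slot j.castSucc a : ProjTensor A (n + 1)) (slot j.succ a) :=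
      (commute_slot_slot (Fin.castSucc_lt_succ).ne a a).neg_left
    have h1 : modular a j
        = slot j.castSucc (NormedSpace.exp (-a)) * slot j.succ (NormedSpace.exp a) := by
      let : NormedAlgebra ℚ (ProjTensor A (n + 1)) :=
        NormedAlgebra.restrictScalars ℚ ℂ (ProjTensor A (n + 1))
      have hn : -slot j.castSucc a = (slot j.castSucc (-a) : ProjTensor A (n + 1)) :=
        (map_neg (slotHom A j.castSucc) a).symm
      rw [modular, nabla, NormedSpace.exp_add_of_commute hc, slot_exp, slot_exp, hn]
    have h2 : (slot j.castSucc (NormedSpace.exp a) : ProjTensor A (n + 1))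
        * slot j.castSucc (NormedSpace.exp (-a)) = 1 := by
      rw [← slotHom_apply, ← slotHom_apply, ← map_mul, exp_mul_exp_neg, map_one]
    rw [modularProd, Fin.partialProd_succ, ← modularProd, ih, h1, mul_assoc,
      ← mul_assoc (slot j.castSucc _), h2, one_mul]

theorem inverse_exp_eq (a : A) : Ring.inverse (NormedSpace.exp a) = NormedSpace.exp (-a) :=
  Ring.inverse_unit ⟨_, _, exp_mul_exp_neg a, exp_neg_mul_exp a⟩

end Slots

theorem spectrum_exp_subset_Ioi {𝒜 : Type*} [CStarAlgebra 𝒜] {a : 𝒜} (ha : IsSelfAdjoint a) :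
    spectrum ℝ (NormedSpace.exp a) ⊆ Ioi 0 := by
  rw [← CFC.real_exp_eq_normedSpace_exp (a := a) ha, cfc_map_spectrum (R := ℝ) Real.exp a]
  rintro _ ⟨x, -, rfl⟩
  exact Real.exp_pos x

/-! ### The families of the substitution lemma -/

section Substitution

open Filter Topology

theorem exists_isCompact_subset_setPow {m : ℕ} {U : Set ℝ} {K : Set (Fin m → ℝ)}
    (hK : IsCompact K) (hKU : K ⊆ setPow m U) :
    ∃ K₁ : Set ℝ, IsCompact K₁ ∧ K₁ ⊆ U ∧ K ⊆ setPow m K₁ := by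
  refine ⟨⋃ j, (fun x : Fin m → ℝ => x j) '' K,
    isCompact_iUnion fun j => hK.image (continuous_apply j), ?_, ?_⟩
  · refine iUnion_subset fun j => ?_
    rintro _ ⟨x, hx, rfl⟩
    exact hKU hx j (mem_univ j)
  · exact fun x hx j _ => mem_iUnion.2 ⟨j, x, hx, rfl⟩

/-- The separation by 1 secures the strict inequality `C₁ < C₂`, even when `K` is empty or a single
point. -/
theorem exists_subset_Icc_of_isCompact {K : Set ℝ} (hK : IsCompact K) (h0 : K ⊆ Ioi 0) :
    ∃ C₁ C₂ : ℝ, 0 < C₁ ∧ C₁ < 1 ∧ 1 < C₂ ∧ K ⊆ Icc C₁ C₂ := by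
  obtain ⟨M, hM⟩ := hK.bddAbove
  rcases K.eq_empty_or_nonempty with rfl | hne
  · exact ⟨1 / 2, 2, by norm_num, by norm_num, by norm_num, empty_subset _⟩
  · obtain ⟨c, hc, hcm⟩ := hK.exists_isLeast hne
    have hc0 : 0 < c := h0 hc
    refine ⟨min c (1 / 2), max M 2, by positivity, (min_le_right _ _).trans_lt (by norm_num),
      lt_of_lt_of_le (by norm_num) (le_max_right _ _), fun x hx => ?_⟩
    exact ⟨(min_le_left _ _).trans (hcm hx), (hM hx).trans (le_max_left _ _)⟩

/-- The affine map `l ↦ (c, l)` has a linear part that carries each basis vector to the one with the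
successor index, so the letters of the word shift by one. -/
theorem iterPartial_comp_cons {n k : ℕ} (i : Fin k → Fin n) {h : (Fin (n + 1) → ℝ) → ℂ}
    (c : ℝ) {l : Fin n → ℝ}
    (hh : ∀ᶠ y in 𝓝 (Fin.cons c l : Fin (n + 1) → ℝ), ContDiffAt ℝ ∞ h y) :
    iterPartial i (fun y => h (Fin.cons c y)) l
      = iterPartial (fun t => (i t).succ) h (Fin.cons c l) := by
  induction k generalizing l with
  | zero => simp only [iterPartial_zero]
  | succ k ih =>
    let κ : (Fin n → ℝ) →L[ℝ] (Fin (n + 1) → ℝ) := ContinuousLinearMap.pi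
      (Fin.cons 0 fun j => ContinuousLinearMap.proj j)
    have hκ : ∃ v, (fun y : Fin n → ℝ => (Fin.cons c y : Fin (n + 1) → ℝ)) = fun y => κ y + v :=
      ⟨Fin.cons c 0, by
        ext y t; refine Fin.cases ?_ (fun t => ?_) t <;> simp [κ]⟩
    obtain ⟨v, hκ⟩ := hκ
    have hd : ∀ y, HasFDerivAt (fun y : Fin n → ℝ => (Fin.cons c y : Fin (n + 1) → ℝ)) κ y := by
      intro y
      rw [hκ]
      exact κ.hasFDerivAt.add_const _
    have hsm : ContDiff ℝ ∞ (fun y : Fin n → ℝ => (Fin.cons c y : Fin (n + 1) → ℝ)) := by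
      rw [hκ]
      exact κ.contDiff.add contDiff_const
    have hev : ∀ᶠ y in 𝓝 l, ∀ᶠ z in 𝓝 (Fin.cons c y : Fin (n + 1) → ℝ), ContDiffAt ℝ ∞ h z :=
      hsm.continuous.continuousAt.eventually hh.eventually_nhds
    rw [iterPartial_succ (f := fun y => h (Fin.cons c y)) i
      (hh.self_of_nhds.comp l hsm.contDiffAt), iterPartial_succ _ hh.self_of_nhds]
    have : iterPartial (Fin.tail i) (fun y => h (Fin.cons c y)) =ᶠ[𝓝 l]
        fun y => iterPartial (fun t => (Fin.tail i t).succ) h (Fin.cons c y) := by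
      filter_upwards [hev] with y hy using ih _ hy
    have hdiff := ((hh.self_of_nhds.iterPartial
      fun t => (Fin.tail i t).succ).differentiableAt (by simp)).hasFDerivAt
    have h5 : HasFDerivAt (fun y : Fin n → ℝ =>
        iterPartial (fun t => (Fin.tail i t).succ) h (Fin.cons c y)) _ l :=
      HasFDerivAt.comp (f := fun y : Fin n → ℝ => (Fin.cons c y : Fin (n + 1) → ℝ)) l hdiff (hd l)
    rw [this.fderiv_eq, h5.fderiv, ContinuousLinearMap.comp_apply]
    congr 1
    ext t
    refine Fin.cases ?_ (fun t => ?_) t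
    · simp [κ, (Fin.succ_ne_zero _).symm]
    · simp [κ, Pi.single_apply]

variable {n : ℕ} {f : (Fin (n + 1) → ℝ) → ℂ}

theorem contDiffAt_of_contDiffOn_setPow_Ici (hf : ContDiffOn ℝ ∞ f (setPow (n + 1) (Ici 0)))
    {x : Fin (n + 1) → ℝ} (hx : x ∈ setPow (n + 1) (Ioi 0)) : ContDiffAt ℝ ∞ f x :=
  hf.contDiffAt (mem_of_superset ((isOpen_setPow isOpen_Ioi).mem_nhds hx)
    (pi_mono fun _ _ => Ioi_subset_Ici_self))

theorem smul_mem_setPow_Ioi {m : ℕ} {u : ℝ} (hu : 0 < u) {x : Fin m → ℝ}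
    (hx : x ∈ setPow m (Ioi 0)) : u • x ∈ setPow m (Ioi 0) :=
  fun j _ => mul_pos hu (hx j (mem_univ j))

theorem cons_one_mem_setPow {S : Set ℝ} (h1 : 1 ∈ S) {l : Fin n → ℝ} (hl : l ∈ setPow n S) :
    (Fin.cons 1 l : Fin (n + 1) → ℝ) ∈ setPow (n + 1) S := by
  intro j _
  refine Fin.cases ?_ (fun i => ?_) j
  · simpa using h1
  · simpa using hl i (mem_univ i)

theorem isIntegrableFamily_smul (hf : ContDiffOn ℝ ∞ f (setPow (n + 1) (Ici 0)))
    (hint : ∀ C₁ C₂ : ℝ, 0 < C₁ → C₁ < C₂ → ∀ (k : ℕ) (i : Fin k → Fin (n + 1)),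
      ∫⁻ u in Ioi (0 : ℝ), ⨆ s ∈ setPow (n + 1) (Icc C₁ C₂),
        ‖(u : ℂ) ^ k * iterPartial i f (u • s)‖ₑ < ⊤) :
    IsIntegrableFamily (setPow (n + 1) (Ioi 0)) fun u s => f (u • s) := by
  constructor
  · intro p hp
    have hs : ContDiff ℝ ∞ fun p : ℝ × (Fin (n + 1) → ℝ) => p.1 • p.2 :=
      contDiff_fst.smul contDiff_snd
    exact ((contDiffAt_of_contDiffOn_setPow_Ici hf (smul_mem_setPow_Ioi hp.1 hp.2)).comp p
      hs.contDiffAt).contDiffWithinAt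
  · intro K hK hKP k i
    obtain ⟨K₁, hK₁, hK₁U, hKK₁⟩ := exists_isCompact_subset_setPow hK hKP
    obtain ⟨C₁, C₂, h0, h1, h2, hC⟩ := exists_subset_Icc_of_isCompact hK₁ hK₁U
    refine lt_of_le_of_lt (setLIntegral_mono' measurableSet_Ioi fun u hu => ?_)
      (hint C₁ C₂ h0 (h1.trans h2) k i)
    refine iSup₂_le fun x hx => ?_
    have hxP := smul_mem_setPow_Ioi hu (hKP hx)
    rw [iterPartial_comp_smul i (by
      filter_upwards [(isOpen_setPow isOpen_Ioi).mem_nhds hxP] with y hy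
        using contDiffAt_of_contDiffOn_setPow_Ici hf hy)]
    exact le_iSup₂ (f := fun s (_ : s ∈ setPow (n + 1) (Icc C₁ C₂)) =>
      ‖(u : ℂ) ^ k * iterPartial i f (u • s)‖ₑ) x (pi_mono (fun _ _ => hC) (hKK₁ hx))

theorem isIntegrableFamily_smul_cons (hf : ContDiffOn ℝ ∞ f (setPow (n + 1) (Ici 0)))
    (hint : ∀ C₁ C₂ : ℝ, 0 < C₁ → C₁ < C₂ → ∀ (k : ℕ) (i : Fin k → Fin (n + 1)),
      ∫⁻ u in Ioi (0 : ℝ), ⨆ s ∈ setPow (n + 1) (Icc C₁ C₂),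
        ‖(u : ℂ) ^ k * iterPartial i f (u • s)‖ₑ < ⊤) :
    IsIntegrableFamily (setPow n (Ioi 0)) fun u l => f (u • (Fin.cons 1 l)) := by
  have hF := isIntegrableFamily_smul hf hint
  have hcons : ContDiff ℝ ∞ fun l : Fin n → ℝ => (Fin.cons 1 l : Fin (n + 1) → ℝ) := by
    refine contDiff_pi.2 fun j => ?_
    refine Fin.cases ?_ (fun i => ?_) j
    · exact contDiff_const
    · exact contDiff_apply ℝ ℝ i
  constructor
  · exact hF.contDiffOn.comp (f := fun p : ℝ × (Fin n → ℝ) =>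
      (p.1, (Fin.cons 1 p.2 : Fin (n + 1) → ℝ)))
      (contDiff_fst.prodMk (hcons.comp contDiff_snd)).contDiffOn
      fun p hp => ⟨hp.1, cons_one_mem_setPow (mem_Ioi.2 one_pos) hp.2⟩
  · intro K hK hKQ k i
    refine lt_of_le_of_lt (setLIntegral_mono' measurableSet_Ioi fun u hu => ?_)
      (hF.lintegral_lt_top ((fun l => Fin.cons 1 l) '' K) (hK.image hcons.continuous)
        (image_subset_iff.2 fun l hl => cons_one_mem_setPow (mem_Ioi.2 one_pos) (hKQ hl)) k
        fun t => (i t).succ)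
    refine iSup₂_le fun l hl => ?_
    have hP : (Fin.cons 1 l : Fin (n + 1) → ℝ) ∈ setPow (n + 1) (Ioi 0) :=
      cons_one_mem_setPow (mem_Ioi.2 one_pos) (hKQ hl)
    rw [iterPartial_comp_cons (h := fun s => f (u • s)) i 1 (by
      filter_upwards [(isOpen_setPow isOpen_Ioi).mem_nhds hP] with y hy
        using hF.contDiffAt (isOpen_setPow isOpen_Ioi) hu hy)]
    exact le_iSup₂ (f := fun s (_ : s ∈ (fun l : Fin n → ℝ =>
      (Fin.cons 1 l : Fin (n + 1) → ℝ)) '' K) =>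
      ‖iterPartial (fun t => (i t).succ) (fun s => f (u • s)) s‖ₑ) _ (mem_image_of_mem _ hl)

/-- Since `u s = (u s₀)(1, s₁/s₀, …)`, this is the substitution `u ↦ u s₀`. Its Jacobian is the
origin of the factor `A⁻¹` in the substitution lemma. -/
theorem setIntegral_smul_eq (f : (Fin (n + 1) → ℝ) → ℂ) {s : Fin (n + 1) → ℝ} (hs : 0 < s 0) :
    ∫ u in Ioi (0 : ℝ), f (u • s)
      = ((s 0)⁻¹ : ℂ) * ∫ u in Ioi (0 : ℝ), f (u • Fin.cons 1 fun j => s (Fin.succ j) / s 0) := by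
  have h := integral_comp_mul_right_Ioi
    (fun u : ℝ => f (u • (Fin.cons 1 fun j => s (Fin.succ j) / s 0 : Fin (n + 1) → ℝ))) 0 hs
  rw [zero_mul] at h
  rw [← Complex.ofReal_inv, ← Complex.real_smul, ← h]
  congr 1
  ext u
  congr 1
  ext j
  refine Fin.cases ?_ (fun i => ?_) j
  · simp
  · simp only [Pi.smul_apply, Fin.cons_succ, smul_eq_mul]
    field_simp

/-- The calculus of `u • b` in terms of the calculus of `b`. -/
theorem IsSmoothCalculus.comp_smul {m : ℕ} {B : Type*} [NormedRing B] [NormedAlgebra ℂ B]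
    {b : Fin m → B} {Φ : smoothAlg (setPow m (Ioi 0)) →ₐ[ℂ] B}
    (hΦ : IsSmoothCalculus (setPow m (Ioi 0)) b Φ) {u : ℝ} (hu : 0 < u) :
    HasSmoothCalculus (setPow m (Ioi 0)) (fun j => (u : ℂ) • b j) ∧
      ∀ f, ContDiffOn ℝ ∞ f (setPow m (Ioi 0)) →
        smoothCalc (setPow m (Ioi 0)) f (fun j => (u : ℂ) • b j)
          = smoothCalc (setPow m (Ioi 0)) (fun x => f (u • x)) b := by
  have hP := isOpen_setPow (m := m) (isOpen_Ioi (a := (0 : ℝ)))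
  have hρ : ContDiffOn ℝ ∞ (fun x : Fin m → ℝ => u • x) (setPow m (Ioi 0)) :=
    (contDiff_const_smul u).contDiffOn
  have hmaps : MapsTo (fun x : Fin m → ℝ => u • x) (setPow m (Ioi 0)) (setPow m (Ioi 0)) :=
    fun x hx => smul_mem_setPow_Ioi hu hx
  obtain ⟨Ψ, hΨ, hΨe⟩ := hΦ.comp hP hP hρ hmaps (b' := fun j => (u : ℂ) • b j) fun j hj => by
    rw [← hΦ.map_coord j, ← map_smul]
    refine hΦ.congr hP fun x _ => ?_
    simp [smoothCoord]
  refine ⟨hΨ.hasSmoothCalculus hP, fun f hf => ?_⟩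
  rw [hΨ.smoothCalc_eq hP hf, hΨe f hf (hf.comp hρ hmaps), ← hΦ.smoothCalc_eq hP]

/-- The calculus of `(u, u b_1, …, u b_n)` in terms of the calculus of `(b_1, …, b_n)`. -/
theorem IsSmoothCalculus.comp_smul_cons {B : Type*} [NormedRing B] [NormedAlgebra ℂ B]
    {b : Fin (n + 1) → B} (hb : b 0 = 1) {Φ : smoothAlg (setPow n (Ioi 0)) →ₐ[ℂ] B}
    (hΦ : IsSmoothCalculus (setPow n (Ioi 0)) (fun j => b j.succ) Φ) {u : ℝ} (hu : 0 < u) :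
    HasSmoothCalculus (setPow (n + 1) (Ioi 0)) (fun j => (u : ℂ) • b j) ∧
      ∀ f, ContDiffOn ℝ ∞ f (setPow (n + 1) (Ioi 0)) →
        smoothCalc (setPow (n + 1) (Ioi 0)) f (fun j => (u : ℂ) • b j)
          = smoothCalc (setPow n (Ioi 0)) (fun l => f (u • (Fin.cons 1 l)))
            (fun j => b j.succ) := by
  have hP := isOpen_setPow (m := n + 1) (isOpen_Ioi (a := (0 : ℝ)))
  have hQ := isOpen_setPow (m := n) (isOpen_Ioi (a := (0 : ℝ)))
  have hρ : ContDiffOn ℝ ∞ (fun l : Fin n → ℝ => u • (Fin.cons 1 l : Fin (n + 1) → ℝ))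
      (setPow n (Ioi 0)) := by
    refine ContDiff.contDiffOn (contDiff_pi.2 fun j => ?_)
    refine Fin.cases ?_ (fun i => ?_) j
    · change ContDiff ℝ ∞ fun _ : Fin n → ℝ => u * 1
      exact contDiff_const
    · change ContDiff ℝ ∞ fun l : Fin n → ℝ => u * l i
      exact contDiff_const.mul (contDiff_apply ℝ ℝ i)
  have hmaps : MapsTo (fun l : Fin n → ℝ => u • (Fin.cons 1 l : Fin (n + 1) → ℝ))
      (setPow n (Ioi 0)) (setPow (n + 1) (Ioi 0)) := fun l hl =>
    smul_mem_setPow_Ioi hu (cons_one_mem_setPow (mem_Ioi.2 one_pos) hl)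
  -- The coordinate 0 of the map is the constant `u`, which a unital homomorphism sends to `u • 1 =
  -- u • b 0`.
  obtain ⟨Ψ, hΨ, hΨe⟩ := hΦ.comp hQ hP hρ hmaps (b' := fun j => (u : ℂ) • b j) fun j hj => by
    revert hj
    refine Fin.cases (fun hj => ?_) (fun i hj => ?_) j
    · rw [hb, ← map_one Φ, ← map_smul]
      refine hΦ.congr hQ fun x _ => ?_
      simp
    · rw [← hΦ.map_coord i, ← map_smul]
      refine hΦ.congr hQ fun x _ => ?_
      simp [smoothCoord]
  refine ⟨hΨ.hasSmoothCalculus hP, fun f hf => ?_⟩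
  rw [hΨ.smoothCalc_eq hP hf, hΨe f hf (hf.comp hρ hmaps), ← hΦ.smoothCalc_eq hQ]

theorem ne_zero_of_mem_setPow_Ioi {x : Fin (n + 1) → ℝ} (hx : x ∈ setPow (n + 1) (Ioi 0)) :
    x 0 ≠ 0 := (hx 0 (mem_univ 0)).ne'

theorem contDiffOn_inv_zero : ContDiffOn ℝ ∞ (fun x : Fin (n + 1) → ℝ => ((x 0)⁻¹ : ℂ))
    (setPow (n + 1) (Ioi 0)) :=
  (Complex.ofRealCLM.contDiff.comp (contDiff_apply ℝ ℝ (0 : Fin (n + 1)))).contDiffOn.inv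
    fun _ hx => Complex.ofReal_ne_zero.2 (ne_zero_of_mem_setPow_Ioi hx)

variable {𝒜 : Type*} [CStarAlgebra 𝒜] {a : 𝒜}
  {Φ : smoothAlg (setPow (n + 1) (Ioi 0)) →ₐ[ℂ] ProjTensor 𝒜 (n + 1)}

/-- Both sides invert the slot 0 of `e^a`: the left one because `x₀⁻¹ x₀ = 1` on the positive
orthant, the right one because a slot embedding is multiplicative. -/
theorem IsSmoothCalculus.map_inv_zero
    (hΦ : IsSmoothCalculus (setPow (n + 1) (Ioi 0)) (fun j => slot j (NormedSpace.exp a)) Φ) :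
    Φ ⟨_, contDiffOn_inv_zero⟩ = slot 0 (NormedSpace.exp (-a)) := by
  have h1 : Φ ⟨_, contDiffOn_inv_zero⟩ * slot 0 (NormedSpace.exp a) = 1 := by
    rw [← hΦ.map_coord 0, ← map_mul, ← map_one Φ]
    refine hΦ.congr (isOpen_setPow isOpen_Ioi) fun x hx => ?_
    have := Complex.ofReal_ne_zero.2 (ne_zero_of_mem_setPow_Ioi hx)
    simp [smoothCoord, this]
  have h2 : (slot 0 (NormedSpace.exp a) : ProjTensor 𝒜 (n + 1)) * slot 0 (NormedSpace.exp (-a))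
      = 1 := by
    rw [← slotHom_apply, ← slotHom_apply, ← map_mul, exp_mul_exp_neg, map_one]
  exact left_inv_eq_right_inv h1 h2

/-- The calculus of `(Δ₁, Δ₁Δ₂, …)` in terms of the calculus of the slots of `e^a`. -/
theorem IsSmoothCalculus.exists_modularProd
    (hΦ : IsSmoothCalculus (setPow (n + 1) (Ioi 0)) (fun j => slot j (NormedSpace.exp a)) Φ) :
    ∃ Ψ : smoothAlg (setPow n (Ioi 0)) →ₐ[ℂ] ProjTensor 𝒜 (n + 1),
      IsSmoothCalculus (setPow n (Ioi 0)) (fun j => modularProd a j.succ) Ψ ∧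
      ∀ G (hG : ContDiffOn ℝ ∞ G (setPow n (Ioi 0)))
        (F : smoothAlg (setPow (n + 1) (Ioi 0))),
        (∀ s ∈ setPow (n + 1) (Ioi 0), (F : (Fin (n + 1) → ℝ) → ℂ) s
          = ((s 0)⁻¹ : ℂ) * G fun j => s (Fin.succ j) / s 0) →
        Φ F = slot 0 (NormedSpace.exp (-a)) * Ψ ⟨G, hG⟩ := by
  have hP := isOpen_setPow (m := n + 1) (isOpen_Ioi (a := (0 : ℝ)))
  have hQ := isOpen_setPow (m := n) (isOpen_Ioi (a := (0 : ℝ)))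
  have hρ : ContDiffOn ℝ ∞ (fun (x : Fin (n + 1) → ℝ) (j : Fin n) => x j.succ / x 0)
      (setPow (n + 1) (Ioi 0)) :=
    contDiffOn_pi.2 fun j => (contDiff_apply ℝ ℝ j.succ).contDiffOn.div
      (contDiff_apply ℝ ℝ (0 : Fin (n + 1))).contDiffOn fun x hx => ne_zero_of_mem_setPow_Ioi hx
  have hmaps : MapsTo (fun (x : Fin (n + 1) → ℝ) (j : Fin n) => x j.succ / x 0)
      (setPow (n + 1) (Ioi 0)) (setPow n (Ioi 0)) := fun x hx j _ =>
    mem_Ioi.2 (div_pos (hx j.succ (mem_univ _)) (hx 0 (mem_univ _)))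
  -- Pulling back along the quotients `x_j / x₀` sends the coordinates to `(A⁻¹)^{(0)} A^{(j)}`, the
  -- telescoped modular products.
  obtain ⟨Ψ, hΨ, hΨe⟩ := hΦ.comp hP hQ hρ hmaps (b' := fun j => modularProd a j.succ)
    fun j hj => by
      rw [modularProd_eq, ← hΦ.map_inv_zero, ← hΦ.map_coord j.succ, ← map_mul]
      refine hΦ.congr hP fun x hx => ?_
      simp [smoothCoord, div_eq_inv_mul]
  refine ⟨Ψ, hΨ, fun G hG F hF => ?_⟩
  rw [hΨe G hG (hG.comp hρ hmaps), ← hΦ.map_inv_zero, ← map_mul]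
  exact hΦ.congr hP hF

end Substitution

/-! ### The substitution lemma -/

theorem mainTheorem4 {𝒜 : Type*} [CStarAlgebra 𝒜] (n : ℕ) (a A : 𝒜) (ha : IsSelfAdjoint a)
    (hA : A = NormedSpace.exp a) :
    -- first part
    (∀ (U : Set ℝ) (_ : IsOpen U) (_ : spectrum ℝ A ⊆ U) (f : ℝ → (Fin (n + 1) → ℝ) → ℂ)
        (_ : ContDiffOn ℝ ∞ (fun p : ℝ × (Fin (n + 1) → ℝ) => f p.1 p.2)
          (Ici 0 ×ˢ setPow (n + 1) U))
        (_ : ∀ K : Set ℝ, IsCompact K → K ⊆ U → ∀ (k : ℕ) (i : Fin k → Fin (n + 1)),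
          ∫⁻ u in Ioi (0 : ℝ), ⨆ x ∈ setPow (n + 1) K, ‖iterPartial i (f u) x‖ₑ < ⊤),
      let F : (Fin (n + 1) → ℝ) → ℂ := fun x => ∫ u in Ioi (0 : ℝ), f u x
      let Aj : Fin (n + 1) → ProjTensor 𝒜 (n + 1) := fun j => slot j A
      HasSmoothCalculus (setPow (n + 1) U) Aj ∧
      (∀ x ∈ setPow (n + 1) U, IntegrableOn (fun u => f u x) (Ioi 0)) ∧
      ContDiffOn ℝ ∞ F (setPow (n + 1) U) ∧
      IntegrableOn (fun u => smoothCalc (setPow (n + 1) U) (f u) Aj) (Ioi 0) ∧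
      (∫ u in Ioi (0 : ℝ), smoothCalc (setPow (n + 1) U) (f u) Aj)
        = smoothCalc (setPow (n + 1) U) F Aj) ∧
    -- second part
    (∀ (f : (Fin (n + 1) → ℝ) → ℂ)
        (_ : ContDiffOn ℝ ∞ f (setPow (n + 1) (Ici 0)))
        (_ : ∀ C₁ C₂ : ℝ, 0 < C₁ → C₁ < C₂ → ∀ (k : ℕ) (i : Fin k → Fin (n + 1)),
          ∫⁻ u in Ioi (0 : ℝ), ⨆ s ∈ setPow (n + 1) (Icc C₁ C₂),
            ‖(u : ℂ) ^ k * iterPartial i f (u • s)‖ₑ < ⊤),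
      let P : Set (Fin (n + 1) → ℝ) := setPow (n + 1) (Ioi 0)
      let Q : Set (Fin n → ℝ) := setPow n (Ioi 0)
      let F : (Fin (n + 1) → ℝ) → ℂ := fun s => ∫ u in Ioi (0 : ℝ), f (u • s)
      let G : (Fin n → ℝ) → ℂ := fun l => ∫ u in Ioi (0 : ℝ), f (u • (Fin.cons 1 l))
      let Aj : Fin (n + 1) → ProjTensor 𝒜 (n + 1) := fun j => slot j A
      let Dj : Fin (n + 1) → ProjTensor 𝒜 (n + 1) := modularProd a
      -- all the functional calculi below exist and are unique
      HasSmoothCalculus P Aj ∧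
      HasSmoothCalculus Q (fun j => Dj j.succ) ∧
      (∀ u : ℝ, 0 < u → HasSmoothCalculus P (fun j => (u : ℂ) • Aj j)) ∧
      (∀ u : ℝ, 0 < u → HasSmoothCalculus P (fun j => (u : ℂ) • Dj j)) ∧
      -- `F` and `G` are defined by absolutely convergent integrals and smooth
      (∀ s ∈ P, IntegrableOn (fun u : ℝ => f (u • s)) (Ioi 0)) ∧
      (∀ l ∈ Q, IntegrableOn (fun u : ℝ => f (u • (Fin.cons 1 l))) (Ioi 0)) ∧
      ContDiffOn ℝ ∞ F P ∧
      ContDiffOn ℝ ∞ G Q ∧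
      -- both integrals exist in the Bochner sense
      IntegrableOn (fun u : ℝ => smoothCalc P f (fun j => (u : ℂ) • Aj j)) (Ioi 0) ∧
      IntegrableOn (fun u : ℝ => smoothCalc P f (fun j => (u : ℂ) • Dj j)) (Ioi 0) ∧
      -- the three identities
      (∫ u in Ioi (0 : ℝ), smoothCalc P f (fun j => (u : ℂ) • Aj j)) = smoothCalc P F Aj ∧
      smoothCalc P F Aj = slot 0 (Ring.inverse A) * smoothCalc Q G (fun j => Dj j.succ) ∧
      slot 0 (Ring.inverse A) * smoothCalc Q G (fun j => Dj j.succ)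
        = slot 0 (Ring.inverse A) *
          (∫ u in Ioi (0 : ℝ), smoothCalc P f (fun j => (u : ℂ) • Dj j))) := by
  subst hA
  have hsa : IsSelfAdjoint (NormedSpace.exp a) := ha.exp
  refine ⟨fun U hU hspec f hf hint => ?_, fun f hf hint => ?_⟩
  · intro F Aj
    have hV := isOpen_setPow (m := n + 1) hU
    obtain ⟨Φ, hΦ⟩ := exists_isSmoothCalculus_slot (m := n + 1) hsa hU hspec
    have hfam : IsIntegrableFamily (setPow (n + 1) U) f := by
      refine ⟨hf.mono (prod_mono Ioi_subset_Ici_self Subset.rfl), fun K hK hKV k i => ?_⟩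
      -- The hypothesis concerns cubes `K₁^{n+1}` only; a compact set lies in the cube over the
      -- union of its coordinate projections.
      obtain ⟨K₁, hK₁, hK₁U, hKK₁⟩ := exists_isCompact_subset_setPow hK hKV
      refine lt_of_le_of_lt (lintegral_mono fun u => ?_) (hint K₁ hK₁ hK₁U k i)
      exact biSup_mono fun x hx => hKK₁ hx
    have h := hfam.integrableOn_smoothCalc hV hΦ
    refine ⟨hΦ.hasSmoothCalculus hV, fun x hx => ?_, hfam.contDiffOn_integral hV, h.1, h.2⟩
    simpa only [iterPartial_zero] using
      hfam.integrableOn_iterPartial hV hx (Fin.elim0 : Fin 0 → Fin (n + 1))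
  · intro P Q F G Aj Dj
    have hP : IsOpen P := isOpen_setPow isOpen_Ioi
    have hQ : IsOpen Q := isOpen_setPow isOpen_Ioi
    have hfP : ContDiffOn ℝ ∞ f P := hf.mono (pi_mono fun _ _ => Ioi_subset_Ici_self)
    obtain ⟨Φ, hΦ⟩ := exists_isSmoothCalculus_slot (m := n + 1) hsa isOpen_Ioi
      (spectrum_exp_subset_Ioi ha)
    obtain ⟨Ψ, hΨ, hΨe⟩ := hΦ.exists_modularProd
    have hfam := isIntegrableFamily_smul hf hint
    have hfam' := isIntegrableFamily_smul_cons hf hint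
    have hA := fun (u : ℝ) (hu : 0 < u) => hΦ.comp_smul hu
    have hD := fun (u : ℝ) (hu : 0 < u) =>
      hΨ.comp_smul_cons (b := Dj) (Fin.partialProd_zero _) hu
    obtain ⟨h1, h2⟩ := hfam.integrableOn_smoothCalc hP hΦ
    obtain ⟨h3, h4⟩ := hfam'.integrableOn_smoothCalc hQ hΨ
    have hF : ContDiffOn ℝ ∞ F P := hfam.contDiffOn_integral hP
    have hG : ContDiffOn ℝ ∞ G Q := hfam'.contDiffOn_integral hQ
    -- For each `u > 0` the integrand is the calculus of the modular products applied to `l ↦ f(u, u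
    -- l)`, and this family may be integrated under the calculus.
    have hDint : (∫ u in Ioi (0 : ℝ), smoothCalc P f (fun j => (u : ℂ) • Dj j))
        = smoothCalc Q G (fun j => Dj j.succ) :=
      (setIntegral_congr_fun measurableSet_Ioi fun u hu => (hD u hu).2 f hfP).trans h4
    refine ⟨hΦ.hasSmoothCalculus hP, hΨ.hasSmoothCalculus hQ, fun u hu => (hA u hu).1,
      fun u hu => (hD u hu).1, fun s hs => ?_, fun l hl => ?_, hF, hG,
      h1.congr_fun (fun u hu => ((hA u hu).2 f hfP).symm) measurableSet_Ioi,
      h3.congr_fun (fun u hu => ((hD u hu).2 f hfP).symm) measurableSet_Ioi,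
      (setIntegral_congr_fun measurableSet_Ioi fun u hu => (hA u hu).2 f hfP).trans h2, ?_, ?_⟩
    · simpa only [iterPartial_zero] using
        hfam.integrableOn_iterPartial hP hs (Fin.elim0 : Fin 0 → Fin (n + 1))
    · simpa only [iterPartial_zero] using
        hfam'.integrableOn_iterPartial hQ hl (Fin.elim0 : Fin 0 → Fin n)
    · rw [hΦ.smoothCalc_eq hP hF, hΨ.smoothCalc_eq hQ hG, inverse_exp_eq]
      -- The operator identity is the image under `Φ` of the scalar identity `F(s) = s₀⁻¹ G(s₁/s₀,
      -- …)`.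
      exact hΨe G hG ⟨F, hF⟩ fun s hs => setIntegral_smul_eq f (hs 0 (mem_univ 0))
    · rw [hDint]
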